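/- **Perfect importance weights.** *Setting.* Patients have covariates $X\in\mathcal X$ (a standard Borel space), a binary treatment $A$, and indicators $Y_k, D_k$ ($k=1,2,\dots$) that the main, respectively competing, event has occurred by period $k$; within a period $D_k$ precedes $Y_k$, and either event precludes the other. Consider one of the interventions $do(A=a)$ (total effect), $do(A=a,\bar D=0)$ (direct effect, which eliminates the competing event), or $do(A_Y=a,A_D=a_D)$ (separable effect, where $A_Y$ and $A_D$ are the components of the treatment that act on the main and on the competing event), and fix a period $k\ge 1$. Let $p^{obs}_{a,k}$ be the law of $X$ given $\bar Y_{k-1}=\bar D_k=0$ and $A=a$, let $p^{int}_{a,k}$ be the law of $X$ given that the counterfactual indicators under the intervention satisfy $\bar Y_{k-1}=\bar D_k=0$ (both events being assumed to have positive probability), and let $h_Y(k,x,a)=\mathbb P(Y_k=1\mid \bar D_k=\bar Y_{k-1}=0,X=x,A=a)$. Let $\mathcal H$ be a jointly measurable class of hypotheses $h:\mathcal X\to\mathbb R$ (indexed by a standard Borel space), let $\ell$ be a measurable loss with $\ell(y,h(x))\in[0,1]$ for all $h\in\mathcal H$, $x\in\mathcal X$, $y\in\{0,1\}$, and suppose that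 the class $\{\ell_h:(x,y)\mapsto \ell(y,h(x)) : h\in\mathcal H\}$ has finite pseudo-dimension $d$. Put $$R^{int}_{a,k}(h)=\mathbb E_{X\sim p^{int}_{a,k},\,Y_k\sim \mathrm{Bernoulli}(h_Y(k,X,a))}[\ell(Y_k,h(X))],\qquad w^*_{a,k}=\frac{dp^{int}_{a,k}}{dp^{obs}_{a,k}} .$$ From an i.i.d. sample of $n$ patients let $\mathcal I$ be the at-risk set, i.e. the set of indices $i$ with $\bar Y_{k-1,i}=\bar D_{k,i}=0$ and $A_i=a$, let $n^Y_{a,k}=|\mathcal I|$, and let $$\hat R^{w^*,obs}_{a,k}(h)=\frac1{n^Y_{a,k}}\sum_{i\in\mathcal I}w^*_{a,k}(X_i)\,\ell(Y_{k,i},h(X_i)).$$ *Claim.* Let $0<\delta<1$. Conditionally on the at-risk set $\mathcal I$, whenever $n^Y_{a,k}\ge 1$ and $d\le 2n^Y_{a,k}$, with probability at least $1-\delta$ over the at-risk sample the following holds simultaneously for all $h\in\mathcal H$: $$R^{int}_{a,k}(h)-\hat R^{w^*,obs}_{a,k}(h)\;\le\;\frac{1}{\sqrt{ESS^*_{rel}}\;(n^Y_{a,k})^{3/8}}\;2^{5/4}\Big(d\log\frac{2e\,n^Y_{a,k}}{d}+\log\frac4\delta\Big)^{3/8},$$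 where $ESS^*_{rel}=2^{-D_2(p^{int}_{a,k}\|p^{obs}_{a,k})}$ is the expected relative effective sample size and $D_2(p\|q)=\log_2\mathbb E_{x\sim p}\big[\tfrac{p(x)}{q(x)}\big]$ is the Rényi divergence of order 2 ($D_2=+\infty$ if $p\not\ll q$; the right side is $+\infty$ if $D_2=+\infty$). For $d=0$ the term $d\log(2e\,n^Y_{a,k}/d)$ is read as $0$. -/

import Mathlib

open MeasureTheory ProbabilityTheory
open scoped ENNReal

noncomputable section

namespace CompetingEvents

/-- A population of patients with a binary baseline treatment and two competing events, in discrete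
time `k = 1, 2, …`. An element of `Ω` is a patient (with all hidden exogenous randomness), `X` the
pre-treatment covariates, `A` the treatment naturally received. For a patient who has had no event
before period `k`, `mechD k aD ω` says whether the competing event occurs in period `k` if the
treatment component acting on it is set to `aD`; for a patient who in addition does not have the
competing event in period `k`, `mechY k aY ω` says whether the main event occurs in period `k` if
the component acting on it is set to `aY`. Nothing is assumed about how `X`, `A` and the two
mechanisms depend on each other. -/
structure Population (Ω 𝒳 : Type*) [MeasurableSpace Ω] [MeasurableSpace 𝒳] where
  X : Ω → 𝒳
  A : Ω → Bool
  mechY : ℕ → Bool → Ω → Bool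
  mechD : ℕ → Bool → Ω → Bool
  measurable_X : Measurable X
  measurable_A : Measurable A
  measurable_mechY : ∀ k a, Measurable (mechY k a)
  measurable_mechD : ∀ k a, Measurable (mechD k a)

/-- The interventions: `total a` is `do(A = a)`; `direct a` is `do(A = a, D̄ = 0)`, which eliminates
the competing event; `separable aY aD` is `do(A_Y = aY, A_D = aD)`. -/
inductive Intervention
  | total (a : Bool)
  | direct (a : Bool)
  | separable (aY aD : Bool)

namespace Intervention

/-- The value to which the treatment component acting on the main event is set. This is also the
treatment arm `a` whose observed at-risk patients are used for training. -/
def armY : Intervention → Bool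
  | total a => a
  | direct a => a
  | separable aY _ => aY

/-- The value to which the treatment component acting on the competing event is set. -/
def armD : Intervention → Bool
  | total a => a
  | direct a => a
  | separable _ aD => aD

/-- Whether the competing event is eliminated. -/
def eliminates : Intervention → Bool
  | total _ => false
  | direct _ => true
  | separable _ _ => false

end Intervention

namespace Population

variable {Ω 𝒳 : Type*} [MeasurableSpace Ω] [MeasurableSpace 𝒳]

/-- The pair `(Y_k, D_k)` of indicators that the main / competing event has occurred by period `k`
when the treatment components are set to `aY`, `aD` and, if `elim` holds, the competing event is
eliminated. Within a period `D` precedes `Y`, and each event precludes the other. -/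
def events (P : Population Ω 𝒳) (aY aD elim : Bool) (ω : Ω) : ℕ → Bool × Bool
  | 0 => (false, false)
  | k + 1 =>
    let y := (P.events aY aD elim ω k).1
    let d := (P.events aY aD elim ω k).2
    let d' := !elim && (d || (!y && P.mechD (k + 1) aD ω))
    (y || (!d' && P.mechY (k + 1) aY ω), d')

/-- The observed main event indicator `Y_k`. -/
def Y (P : Population Ω 𝒳) (k : ℕ) (ω : Ω) : Bool := (P.events (P.A ω) (P.A ω) false ω k).1

/-- The observed competing event indicator `D_k`. -/
def D (P : Population Ω 𝒳) (k : ℕ) (ω : Ω) : Bool := (P.events (P.A ω) (P.A ω) false ω k).2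

/-- The counterfactual main event indicator `Y_k` under an intervention. -/
def Yint (P : Population Ω 𝒳) (v : Intervention) (k : ℕ) (ω : Ω) : Bool :=
  (P.events v.armY v.armD v.eliminates ω k).1

/-- The counterfactual competing event indicator `D_k` under an intervention. -/
def Dint (P : Population Ω 𝒳) (v : Intervention) (k : ℕ) (ω : Ω) : Bool :=
  (P.events v.armY v.armD v.eliminates ω k).2

/-- The observed main at-risk event in arm `a` at time `k`: `Ȳ_{k-1} = D̄_k = 0` and `A = a`. -/
def atRisk (P : Population Ω 𝒳) (a : Bool) (k : ℕ) : Set Ω :=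
  {ω | P.A ω = a ∧ (∀ l < k, P.Y l ω = false) ∧ ∀ l ≤ k, P.D l ω = false}

/-- The main at-risk event at time `k` under an intervention. -/
def atRiskInt (P : Population Ω 𝒳) (v : Intervention) (k : ℕ) : Set Ω :=
  {ω | (∀ l < k, P.Yint v l ω = false) ∧ ∀ l ≤ k, P.Dint v l ω = false}

/-- The observational at-risk covariate distribution. -/
def pObs (P : Population Ω 𝒳) (μ : Measure Ω) (a : Bool) (k : ℕ) : Measure 𝒳 :=
  (ProbabilityTheory.cond μ (P.atRisk a k)).map P.X

/-- The interventional at-risk covariate distribution. -/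
def pInt (P : Population Ω 𝒳) (μ : Measure Ω) (v : Intervention) (k : ℕ) : Measure 𝒳 :=
  (ProbabilityTheory.cond μ (P.atRiskInt v k)).map P.X

/-- The hazard `h_Y(k, x, a) = ℙ(Y_k = 1 | D̄_k = Ȳ_{k-1} = 0, X = x, A = a)` of the main event. -/
def hazardY (P : Population Ω 𝒳) (μ : Measure Ω) (k : ℕ) (x : 𝒳) (a : Bool) : ℝ :=
  (condDistrib (P.Y k) P.X (ProbabilityTheory.cond μ (P.atRisk a k)) x).real {true}

/-- The interventional risk `𝔼[ℓ(Y_k, h(X))]`, where `X` follows the interventional at-risk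
covariate distribution and `Y_k` given `X = x` is Bernoulli with parameter `h_Y(k, x, a)`. -/
def riskInt (P : Population Ω 𝒳) (μ : Measure Ω) (v : Intervention) (k : ℕ)
    (ℓ : Bool → ℝ → ℝ) (h : 𝒳 → ℝ) : ℝ :=
  ∫ x, (P.hazardY μ k x v.armY * ℓ true (h x)
    + (1 - P.hazardY μ k x v.armY) * ℓ false (h x)) ∂(P.pInt μ v k)

/-- The exact importance weight: the density ratio of the interventional and the observational
at-risk covariate distributions. -/
def weightStar (P : Population Ω 𝒳) (μ : Measure Ω) (v : Intervention) (k : ℕ) (x : 𝒳) : ℝ :=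
  ((P.pInt μ v k).rnDeriv (P.pObs μ v.armY k) x).toReal

open scoped Classical in
/-- The main at-risk set of a sample of `n` patients. -/
def atRiskIndices (P : Population Ω 𝒳) (a : Bool) (k : ℕ) {n : ℕ} (s : Fin n → Ω) :
    Finset (Fin n) :=
  {i | s i ∈ P.atRisk a k}

/-- The weighted empirical risk over the at-risk patients of a sample, with weights `w`. -/
def riskEmp (P : Population Ω 𝒳) (w : 𝒳 → ℝ) (a : Bool) (k : ℕ) (ℓ : Bool → ℝ → ℝ) {n : ℕ}
    (s : Fin n → Ω) (h : 𝒳 → ℝ) : ℝ :=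
  (∑ i ∈ P.atRiskIndices a k s, w (P.X (s i)) * ℓ (P.Y k (s i)) (h (P.X (s i))))
    / ((P.atRiskIndices a k s).card : ℝ)

end Population

/-- `G` pseudo-shatters `S`: for some levels `r`, every subset of `S` is cut out by some `g ∈ G`. -/
def PseudoShatters {Z : Type*} (G : Set (Z → ℝ)) (S : Finset Z) : Prop :=
  ∃ r : Z → ℝ, ∀ T ⊆ S, ∃ g ∈ G, ∀ z ∈ S, (r z < g z ↔ z ∈ T)

/-- The pseudo-dimension of a class of real functions. -/
def pseudoDim {Z : Type*} (G : Set (Z → ℝ)) : ℕ∞ :=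
  ⨆ (S : Finset Z) (_ : PseudoShatters G S), (S.card : ℕ∞)

/-- The class `{ℓ_h : h ∈ H}` of pointwise losses `ℓ_h(x, y) = ℓ(y, h(x))`. -/
def lossClass {𝒳 : Type*} (ℓ : Bool → ℝ → ℝ) (H : Set (𝒳 → ℝ)) : Set (𝒳 × Bool → ℝ) :=
  (fun h z => ℓ z.2 (h z.1)) '' H

/-- The class `H` can be written `{f θ : θ ∈ ℝ}` with `(θ, x) ↦ f θ x` jointly measurable. As every
nonempty standard Borel space is a measurable image of `ℝ`, this says that `H` is a jointly
measurable family indexed by such a space; it is the usual measurability condition under which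
suprema over `H` are (universally) measurable. -/
def JointlyMeasurableClass {𝒳 : Type*} [MeasurableSpace 𝒳] (H : Set (𝒳 → ℝ)) : Prop :=
  ∃ f : ℝ → 𝒳 → ℝ, Measurable (Function.uncurry f) ∧ Set.range f = H

open scoped Classical in
/-- The Rényi divergence of order 2 (in bits), `D₂(p‖q) = log₂ 𝔼_{x ∼ p}[p(x) / q(x)]`, which is
infinite if `p` is not absolutely continuous with respect to `q`. -/
def renyiTwo {𝒳 : Type*} [MeasurableSpace 𝒳] (p q : Measure 𝒳) : EReal :=
  if p ≪ q then ENNReal.log (∫⁻ x, p.rnDeriv q x ∂p) / ((Real.log 2 : ℝ) : EReal) else ⊤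

/-- `2 ^ t` for an extended real `t`. -/
def exp2 (t : EReal) : ℝ≥0∞ := EReal.exp (t * ((Real.log 2 : ℝ) : EReal))

/-- The expected relative effective sample size, `2 ^ (-D₂(p‖q))`. -/
def essRel {𝒳 : Type*} [MeasurableSpace 𝒳] (p q : Measure 𝒳) : ℝ≥0∞ := exp2 (-renyiTwo p q)

/-- The complexity term `2^{5/4} (d log (2 e m / d) + log (4 / δ))^{3/8}`; for `d = 0` the first
summand is `0`. -/
def complexityTerm (d m : ℕ) (δ : ℝ) : ℝ :=
  (2 : ℝ) ^ (5 / 4 : ℝ)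
    * (d * Real.log (Real.exp 1 * 2 * m / d) + Real.log (4 / δ)) ^ (3 / 8 : ℝ)

end CompetingEvents

end

/-! Given the at-risk set, its m patients are i.i.d. from the law Q of (X, Y_k) given at-risk
status. If p ≪ q, the interventional risk of h is the Q-mean of w·ℓ_h. What is needed is a uniform
bound on how far sample means of w·ℓ_h fall below their expectations. The weight w may be unbounded,
but its second moment σ² = E_p[dp/dq] is the inverse of the relative effective sample size.

For nonnegative functions, a second moment controls this side: exp(x - x²) ≤ 2 - exp(-x) for x ≥ 0.
Take a ghost sample s' and the kernel ∏ (2 - exp(-f(s'_i))) exp(-f(s_i)). Integrating out s' gives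
at least exp(m(Ef - Ef²) - ∑ f(s_i)) (`exp_le_lintegral_symmKernel`). Averaging over coordinate
swaps between s and s' gives at most 1 for a fixed pattern of values. With N patterns the average is
at most N, even when f depends on s (`sum_symmKernel_interleave_le`). Hence the deviation event has
probability at most N exp(-c) (`measure_exists_deviation_le`). Choosing f as a function of s needs a
measurable selection (`exists_measurable_section`).

Losses rounded down to multiples of 1/(M+1) realize finitely many patterns, counted by Sauer–Shelah
on points × levels (`exists_finset_roundDown`). With λ = t₀/(2σ) the exponent is m t₀²/4. The
exponent 3/8, slower than 1/2, leaves room for the rounding error and the logarithm of M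
(`exists_levels`). -/

noncomputable section

namespace CompetingEvents

/-! ### Measurable selection by compact approximation -/

/-- The outer measure of a continuous image of Baire space is approximated from inside by images
of compact boxes. -/
theorem exists_compact_measure_image {S : Type*} [TopologicalSpace S] [MeasurableSpace S]
    (ν : Measure S) [ν.OuterRegular] (F : (ℕ → ℕ) → S) (hF : Continuous F)
    {c : ℝ≥0∞} (hc : c < ν (Set.range F)) :
    ∃ C : Set (ℕ → ℕ), IsCompact C ∧ c ≤ ν (F '' C) := by
  have step : ∀ (D : {D : Set (ℕ → ℕ) // c < ν (F '' D)}) (k : ℕ),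
      ∃ N : ℕ, c < ν (F '' (D.1 ∩ {x | x k ≤ N})) := by
    rintro ⟨D, hD⟩ k
    have hU : F '' D = ⋃ N : ℕ, F '' (D ∩ {x | x k ≤ N}) := by
      rw [← Set.image_iUnion]
      congr 1
      ext x
      simp only [Set.mem_iUnion, Set.mem_inter_iff, Set.mem_ofPred_eq]
      exact ⟨fun h => ⟨x k, h, le_rfl⟩, fun ⟨_, h, _⟩ => h⟩
    have hdir : Directed (· ⊆ ·) fun N : ℕ => F '' (D ∩ {x | x k ≤ N}) := by
      apply Monotone.directed_le
      intro N M hNM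
      exact Set.image_mono fun x hx => ⟨hx.1, le_trans hx.2 hNM⟩
    -- Continuity along increasing unions holds for arbitrary sets, so the images need not be
    -- measurable.
    rw [hU, hdir.measure_iUnion] at hD
    exact lt_iSup_iff.1 hD
  choose N hN using step
  let D : ℕ → {D : Set (ℕ → ℕ) // c < ν (F '' D)} := fun k =>
    Nat.rec ⟨Set.univ, by rwa [Set.image_univ]⟩ (fun k E => ⟨_, hN E k⟩) k
  let b : ℕ → ℕ := fun k => N (D k) k
  have hDb : ∀ k, (D k).1 = {x | ∀ i < k, x i ≤ b i} := by
    intro k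
    induction k with
    | zero => ext x; simp [D]
    | succ k ih =>
      have : (D (k + 1)).1 = (D k).1 ∩ {x | x k ≤ b k} := rfl
      rw [this, ih]
      ext x
      simp only [Set.mem_inter_iff, Set.mem_ofPred_eq, Nat.lt_succ_iff_lt_or_eq]
      constructor
      · rintro ⟨h1, h2⟩ i (hi | rfl)
        exacts [h1 i hi, h2]
      · exact fun h => ⟨fun i hi => h i (Or.inl hi), h k (Or.inr rfl)⟩
  let C : Set (ℕ → ℕ) := Set.univ.pi fun i => Set.Iic (b i)
  have hC : IsCompact C := isCompact_univ_pi fun i => (Set.finite_Iic (b i)).isCompact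
  refine ⟨C, hC, ?_⟩
  by_contra hlt
  obtain ⟨U, hCU, hUo, hU⟩ := Set.exists_isOpen_lt_of_lt _ _ (not_le.1 hlt)
  have key : ∃ k, (D k).1 ⊆ F ⁻¹' U := by
    by_contra hno
    push Not at hno
    have : ∀ k, ∃ x, x ∈ (D k).1 ∧ x ∉ F ⁻¹' U := fun k => Set.not_subset.1 (hno k)
    choose x hxD hxU using this
    -- Truncation at `b` moves the points into `C` and alters each coordinate for only finitely many
    -- `k`, so the limit is unaffected.
    obtain ⟨y, hyC, φ, hφ, hlim⟩ := hC.tendsto_subseq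
      (x := fun k i => min (x k i) (b i)) fun k i _ => Set.mem_Iic.2 (min_le_right _ _)
    have hlim' : Filter.Tendsto (x ∘ φ) Filter.atTop (nhds y) := by
      rw [tendsto_pi_nhds] at hlim ⊢
      intro i
      refine (hlim i).congr' ?_
      filter_upwards [hφ.tendsto_atTop.eventually (Filter.eventually_gt_atTop i)] with k hk
      have := hxD (φ k)
      rw [hDb] at this
      exact min_eq_left (this i hk)
    have hy : y ∈ F ⁻¹' U := hCU (Set.mem_image_of_mem F hyC)
    obtain ⟨k, hk⟩ := (hlim'.eventually ((hUo.preimage hF).mem_nhds hy)).exists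
    exact hxU _ hk
  obtain ⟨k, hk⟩ := key
  have h1 : ν (F '' (D k).1) ≤ ν U := measure_mono (Set.image_subset_iff.2 hk)
  exact absurd (lt_of_lt_of_le (D k).2 h1) (not_lt.2 hU.le)

/-- A measurable set in `ℝ × S` has a measurable partial section over a measurable set of almost
the same measure as its projection. -/
theorem exists_measurable_section {S : Type*} [MeasurableSpace S] [StandardBorelSpace S]
    (ν : Measure S) [IsFiniteMeasure ν] {G : Set (ℝ × S)} (hG : MeasurableSet G)
    {c : ℝ≥0∞} (hc : c < ν (Prod.snd '' G)) :
    ∃ A : Set S, MeasurableSet A ∧ c ≤ ν A ∧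
      ∃ θ : S → ℝ, Measurable θ ∧ ∀ s ∈ A, (θ s, s) ∈ G := by
  let := upgradeStandardBorel S
  have han := hG.analyticSet
  rw [AnalyticSet] at han
  rcases han with rfl | ⟨f, hf, rfl⟩
  · simp at hc
  rw [← Set.range_comp] at hc
  obtain ⟨C, hC, hcC⟩ := exists_compact_measure_image ν (Prod.snd ∘ f)
    (continuous_snd.comp hf) hc
  have hK : IsCompact (f '' C) := hC.image hf
  have hA : IsCompact (Prod.snd ∘ f '' C) := hC.image (continuous_snd.comp hf)
  have hfib : ∀ s ∈ Prod.snd ∘ f '' C, IsCompact {t | (t, s) ∈ f '' C} ∧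
      {t | (t, s) ∈ f '' C}.Nonempty := by
    rintro s ⟨x, hx, rfl⟩
    constructor
    · have h1 : IsCompact (Prod.fst '' (f '' C ∩ Prod.snd ⁻¹' {(Prod.snd ∘ f) x})) :=
        (hK.inter_right (isClosed_singleton.preimage continuous_snd)).image continuous_fst
      convert h1 using 1
      ext t
      simp only [Set.mem_ofPred_eq, Set.mem_image, Set.mem_inter_iff, Set.mem_preimage,
        Set.mem_singleton_iff]
      constructor
      · rintro ⟨y, hy, hyt⟩
        exact ⟨f y, ⟨⟨y, hy, rfl⟩, by rw [hyt]⟩, by rw [hyt]⟩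
      · rintro ⟨_, ⟨⟨y, hy, rfl⟩, h2⟩, h1⟩
        exact ⟨y, hy, Prod.ext h1 h2⟩
    · exact ⟨(f x).1, x, hx, rfl⟩
  classical
  -- The section takes the least point of each compact fibre. Within the projection, its sublevel
  -- sets are projections of compact sets.
  refine ⟨Prod.snd ∘ f '' C, hA.measurableSet, hcC,
    fun s => if s ∈ Prod.snd ∘ f '' C then sInf {t | (t, s) ∈ f '' C} else 0, ?_, ?_⟩
  · refine measurable_of_Iic fun a => ?_
    have h1 : IsCompact (Prod.snd '' (f '' C ∩ Prod.fst ⁻¹' Set.Iic a)) :=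
      (hK.inter_right (isClosed_Iic.preimage continuous_fst)).image continuous_snd
    have h2 : (fun s => if s ∈ Prod.snd ∘ f '' C then sInf {t | (t, s) ∈ f '' C} else 0) ⁻¹'
          Set.Iic a
        = Prod.snd '' (f '' C ∩ Prod.fst ⁻¹' Set.Iic a) ∪
          ((Prod.snd ∘ f '' C)ᶜ ∩ {_s | (0 : ℝ) ≤ a}) := by
      ext s
      by_cases hs : s ∈ Prod.snd ∘ f '' C
      · simp only [Set.mem_preimage, Set.mem_Iic, Set.mem_union, Set.mem_inter_iff,
          Set.mem_compl_iff, hs, not_true_eq_false, false_and, or_false]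
        constructor
        · intro h
          exact ⟨(_, s), ⟨(hfib s hs).1.sInf_mem (hfib s hs).2, h⟩, rfl⟩
        · rintro ⟨⟨t, s'⟩, ⟨h1, h2⟩, rfl⟩
          exact (csInf_le (hfib _ hs).1.bddBelow h1).trans h2
      · have hs' : s ∉ Prod.snd '' (f '' C ∩ Prod.fst ⁻¹' Set.Iic a) := by
          rintro ⟨_, ⟨⟨x, hx, rfl⟩, _⟩, rfl⟩
          exact hs ⟨x, hx, rfl⟩
        simp only [Set.mem_preimage, if_false, Set.mem_Iic, Set.mem_union, hs',
          Set.mem_inter_iff, Set.mem_compl_iff, hs, not_false_eq_true, true_and, false_or,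
          Set.mem_ofPred_eq]
    rw [h2]
    exact h1.measurableSet.union (hA.measurableSet.compl.inter (MeasurableSet.const _))
  · intro s hs
    simp only [if_pos hs]
    exact Set.image_subset_range f C ((hfib s hs).1.sInf_mem (hfib s hs).2)

/-! ### Rounding and the number of value patterns -/

/-- The largest multiple of `1 / (M + 1)` strictly below a positive real. -/
def roundDown (M : ℕ) (x : ℝ) : ℝ := ((⌈x * (M + 1)⌉₊ - 1 : ℕ) : ℝ) / (M + 1)

theorem measurable_roundDown (M : ℕ) : Measurable (roundDown M) := by
  have h : Measurable fun n : ℕ => ((n - 1 : ℕ) : ℝ) := measurable_from_top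
  exact (h.comp (Nat.measurable_ceil.comp (measurable_id.mul_const _))).div_const _

theorem roundDown_nonneg (M : ℕ) (x : ℝ) : 0 ≤ roundDown M x := by
  unfold roundDown; positivity

theorem roundDown_le (M : ℕ) {x : ℝ} (hx : 0 ≤ x) : roundDown M x ≤ x := by
  have hM : (0 : ℝ) < M + 1 := by positivity
  unfold roundDown
  rw [div_le_iff₀ hM]
  have h := Nat.ceil_lt_add_one (mul_nonneg hx hM.le)
  rcases Nat.eq_zero_or_pos ⌈x * (M + 1)⌉₊ with h0 | h0
  · rw [h0]; simpa using mul_nonneg hx hM.le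
  · rw [Nat.cast_sub h0]; push_cast; linarith

theorem le_roundDown_add (M : ℕ) (x : ℝ) : x ≤ roundDown M x + 1 / (M + 1) := by
  have hM : (0 : ℝ) < M + 1 := by positivity
  unfold roundDown
  rw [← add_div, le_div_iff₀ hM]
  refine (Nat.le_ceil _).trans ?_
  have : ⌈x * (M + 1)⌉₊ ≤ (⌈x * (M + 1)⌉₊ - 1) + 1 := by omega
  exact_mod_cast this

/-- Rounding only sees which of the M interior levels lie strictly below the value; the top level 1
never does when x ≤ 1. Strictness matches the inequality in `PseudoShatters`. -/
theorem roundDown_le_of_levels {M : ℕ} {x y : ℝ} (hx : x ≤ 1)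
    (h : ∀ j : Fin M, ((j : ℝ) + 1) / (M + 1) < x → ((j : ℝ) + 1) / (M + 1) < y) :
    roundDown M x ≤ roundDown M y := by
  have hM : (0 : ℝ) < M + 1 := by positivity
  unfold roundDown
  refine div_le_div_of_nonneg_right (Nat.cast_le.2 ?_) hM.le
  by_contra! hlt
  set a := ⌈x * (M + 1)⌉₊ with ha
  set b := ⌈y * (M + 1)⌉₊ with hb
  have haM : a ≤ M + 1 := by
    rw [ha, Nat.ceil_le]
    push_cast
    nlinarith
  have hlt' : b - 1 < M := by omega
  have h1 : b - 1 + 1 < a := by omega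
  have h2 := h ⟨b - 1, hlt'⟩
  rw [div_lt_iff₀ hM, div_lt_iff₀ hM] at h2
  have h3 : ((b - 1 + 1 : ℕ) : ℝ) < x * (M + 1) := Nat.lt_ceil.1 h1
  push_cast at h3
  have h4 : ((b - 1 + 1 : ℕ) : ℝ) < y * (M + 1) := by push_cast; exact h2 h3
  have := Nat.lt_ceil.2 h4
  omega

/-- The number of rounded value patterns of a class of functions on a finite family of points, in
terms of the pseudo-dimension. -/
theorem exists_finset_roundDown {Z Θ ι : Type*} [Fintype ι] (g : Θ → Z → ℝ)
    (hg : ∀ θ z, g θ z ≤ 1) {d : ℕ}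
    (hd : ∀ S : Finset Z, PseudoShatters (Set.range g) S → S.card ≤ d) (pt : ι → Z) (M : ℕ) :
    ∃ V : Finset (ι → ℝ), V.card ≤ ∑ i ∈ Finset.range (d + 1), (Fintype.card ι * M).choose i ∧
      ∀ θ, (fun i => roundDown M (g θ (pt i))) ∈ V := by
  classical
  let code : Θ → Finset (ι × Fin M) := fun θ =>
    {p | ((p.2 : ℝ) + 1) / (M + 1) < g θ (pt p.1)}
  have hcode : ∀ θ p, p ∈ code θ ↔ ((p.2 : ℝ) + 1) / (M + 1) < g θ (pt p.1) := by
    intro θ p; simp [code]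
  let pat : Θ → ι → ℝ := fun θ i => roundDown M (g θ (pt i))
  have hpat : ∀ θ θ', code θ = code θ' → pat θ = pat θ' := by
    intro θ θ' h
    ext i
    apply le_antisymm
    · refine roundDown_le_of_levels (hg _ _) fun j hj => ?_
      rw [← hcode θ' (i, j), ← h, hcode]
      exact hj
    · refine roundDown_le_of_levels (hg _ _) fun j hj => ?_
      rw [← hcode θ (i, j), h, hcode]
      exact hj
  let 𝒜 : Finset (Finset (ι × Fin M)) := {s | ∃ θ, code θ = s}
  have hcard : 𝒜.card ≤ ∑ i ∈ Finset.range (d + 1), (Fintype.card ι * M).choose i := by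
    have hvc : 𝒜.vcDim ≤ d := by
      refine Finset.sup_le fun S hS => ?_
      rw [Finset.mem_shatterer] at hS
      have hsel : ∀ t ⊆ S, ∃ θ, ∀ p ∈ S, p ∈ code θ ↔ p ∈ t := by
        intro t ht
        obtain ⟨u, hu, hSu⟩ := hS ht
        obtain ⟨θ, rfl⟩ := (Finset.mem_filter.1 hu).2
        refine ⟨θ, fun p hp => ?_⟩
        rw [← hSu, Finset.mem_inter]
        exact ⟨fun h => ⟨hp, h⟩, fun h => h.2⟩
      -- Exceeding a level forces exceeding all lower ones at the same point, so a shattered set has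
      -- at most one level over each point. These levels are then witnesses for pseudo-shattering
      -- the underlying points.
      have hle : ∀ p ∈ S, ∀ q ∈ S, pt p.1 = pt q.1 → p.2 ≤ q.2 → p = q := by
        intro p hp q hq hpq hl
        obtain ⟨θ, hθ⟩ := hsel {q} (Finset.singleton_subset_iff.2 hq)
        have h1 := (hcode _ _).1 ((hθ q hq).2 (Finset.mem_singleton_self q))
        refine Finset.mem_singleton.1 ((hθ p hp).1 ((hcode _ _).2 ?_))
        rw [hpq]
        refine lt_of_le_of_lt ?_ h1
        have : (p.2 : ℝ) ≤ q.2 := by exact_mod_cast hl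
        gcongr
      have hinj : ∀ p ∈ S, ∀ q ∈ S, pt p.1 = pt q.1 → p = q := by
        intro p hp q hq hpq
        rcases le_total p.2 q.2 with h | h
        · exact hle p hp q hq hpq h
        · exact (hle q hq p hp hpq.symm h).symm
      obtain ⟨r, hr⟩ : ∃ r : Z → ℝ, ∀ p ∈ S, r (pt p.1) = ((p.2 : ℝ) + 1) / (M + 1) := by
        refine ⟨fun z => if h : ∃ p ∈ S, pt p.1 = z then ((h.choose.2 : ℝ) + 1) / (M + 1) else 0,
          fun p hp => ?_⟩
        have h : ∃ q ∈ S, pt q.1 = pt p.1 := ⟨p, hp, rfl⟩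
        simp only [dif_pos h]
        rw [hinj _ h.choose_spec.1 p hp h.choose_spec.2]
      rw [← Finset.card_image_of_injOn (f := fun p : ι × Fin M => pt p.1)
        fun p hp q hq h => hinj p hp q hq h]
      refine hd _ ⟨r, fun T _ => ?_⟩
      obtain ⟨θ, hθ⟩ := hsel (S.filter fun p => pt p.1 ∈ T) (Finset.filter_subset _ _)
      refine ⟨g θ, ⟨θ, rfl⟩, fun z hz => ?_⟩
      obtain ⟨p, hp, rfl⟩ := Finset.mem_image.1 hz
      rw [hr p hp, ← hcode, hθ p hp, Finset.mem_filter]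
      exact ⟨fun h => h.2, fun h => ⟨hp, h⟩⟩
    calc 𝒜.card ≤ 𝒜.shatterer.card := 𝒜.card_le_card_shatterer
      _ ≤ ∑ i ∈ Finset.Iic 𝒜.vcDim, (Fintype.card (ι × Fin M)).choose i :=
        Finset.card_shatterer_le_sum_vcDim
      _ ≤ ∑ i ∈ Finset.range (d + 1), (Fintype.card (ι × Fin M)).choose i := by
        refine Finset.sum_le_sum_of_subset fun i hi => ?_
        rw [Finset.mem_Iic] at hi
        exact Finset.mem_range.2 (by omega)
      _ = _ := by rw [Fintype.card_prod, Fintype.card_fin]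
  refine ⟨𝒜.image fun s => if h : ∃ θ, code θ = s then pat h.choose else 0,
    Finset.card_image_le.trans hcard, fun θ => ?_⟩
  have h : ∃ θ', code θ' = code θ := ⟨θ, rfl⟩
  refine Finset.mem_image.2 ⟨code θ, Finset.mem_filter.2 ⟨Finset.mem_univ _, h⟩, ?_⟩
  rw [dif_pos h]
  exact hpat _ _ h.choose_spec

/-- Multiply by (d/n)^d ≤ (d/n)^i, complete the binomial sum, and use (1 + d/n)^n ≤ e^d. -/
theorem sum_choose_le_exp {n d : ℕ} (hdn : d ≤ n) :
    ((∑ i ∈ Finset.range (d + 1), n.choose i : ℕ) : ℝ)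
      ≤ Real.exp (d * Real.log (Real.exp 1 * n / d)) := by
  rcases Nat.eq_zero_or_pos d with rfl | hd
  · simp
  have hn : (0 : ℝ) < n := by exact_mod_cast hd.trans_le hdn
  have hd' : (0 : ℝ) < d := by exact_mod_cast hd
  have hq : (0 : ℝ) < d / n := by positivity
  have hq1 : (d / n : ℝ) ≤ 1 := by rw [div_le_one hn]; exact_mod_cast hdn
  have h1 : ((∑ i ∈ Finset.range (d + 1), n.choose i : ℕ) : ℝ) * (d / n : ℝ) ^ d
      ≤ Real.exp d := by
    calc ((∑ i ∈ Finset.range (d + 1), n.choose i : ℕ) : ℝ) * (d / n : ℝ) ^ d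
        = ∑ i ∈ Finset.range (d + 1), (d / n : ℝ) ^ d * n.choose i := by
          push_cast; rw [Finset.sum_mul]; exact Finset.sum_congr rfl fun _ _ => mul_comm _ _
      _ ≤ ∑ i ∈ Finset.range (d + 1), (d / n : ℝ) ^ i * n.choose i := by
          refine Finset.sum_le_sum fun i hi => ?_
          have : i ≤ d := by have := Finset.mem_range.1 hi; omega
          exact mul_le_mul_of_nonneg_right (pow_le_pow_of_le_one hq.le hq1 this) (by positivity)
      _ ≤ ∑ i ∈ Finset.range (n + 1), (d / n : ℝ) ^ i * n.choose i := by
          refine Finset.sum_le_sum_of_subset_of_nonneg ?_ fun _ _ _ => by positivity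
          exact Finset.range_subset_range.2 (by omega)
      _ = (d / n + 1 : ℝ) ^ n := by rw [add_pow]; simp
      _ ≤ (Real.exp (d / n)) ^ n := by
          gcongr; exact Real.add_one_le_exp _
      _ = Real.exp d := by rw [← Real.exp_nat_mul]; congr 1; field_simp
  have h2 : Real.exp (d * Real.log (Real.exp 1 * n / d)) = Real.exp d / (d / n : ℝ) ^ d := by
    rw [mul_comm, Real.exp_mul, Real.exp_log (by positivity), Real.rpow_natCast,
      ← Real.exp_one_pow d, ← div_pow]
    congr 1; field_simp
  rw [h2, le_div_iff₀ (by positivity)]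
  exact h1

/-! ### One-sided symmetrization with a ghost sample -/

theorem exp_sub_sq_le {x : ℝ} (hx : 0 ≤ x) : Real.exp (x - x ^ 2) ≤ 2 - Real.exp (-x) := by
  have hpos : ∀ y : ℝ, 0 ≤ y → 1 ≤ 2 - Real.exp (-y) := fun y hy => by
    have : Real.exp (-y) ≤ 1 := Real.exp_le_one_iff.2 (by linarith)
    linarith
  -- The logarithmic form vanishes at 0; its derivative is nonnegative because exp(-y) ≥ 1 - y and 2
  -- - exp(-y) ≥ 1.
  have hderiv : ∀ y : ℝ, 0 ≤ y → HasDerivAt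
      (fun y => Real.log (2 - Real.exp (-y)) - y + y ^ 2)
      (Real.exp (-y) / (2 - Real.exp (-y)) - 1 + 2 * y) y := by
    intro y hy
    have h1 : HasDerivAt (fun y : ℝ => 2 - Real.exp (-y)) (Real.exp (-y)) y := by
      simpa using ((hasDerivAt_neg y).exp.const_sub 2)
    have h2 := h1.log (by have := hpos y hy; linarith)
    exact ((h2.sub (hasDerivAt_id' y)).add (hasDerivAt_pow 2 y)).congr_deriv (by simp)
  have hmono : MonotoneOn (fun y => Real.log (2 - Real.exp (-y)) - y + y ^ 2) (Set.Ici 0) := by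
    refine monotoneOn_of_deriv_nonneg (convex_Ici 0)
      (fun y hy => (hderiv y hy).continuousAt.continuousWithinAt) ?_ ?_
    · intro y hy
      rw [interior_Ici] at hy
      exact (hderiv y (le_of_lt hy)).differentiableAt.differentiableWithinAt
    · intro y hy
      rw [interior_Ici] at hy
      have hy0 : 0 ≤ y := le_of_lt hy
      rw [(hderiv y hy0).deriv]
      have hp := hpos y hy0
      have he : 1 - y ≤ Real.exp (-y) := by have := Real.add_one_le_exp (-y); linarith
      rw [show Real.exp (-y) / (2 - Real.exp (-y)) - 1 + 2 * y
        = 2 * (Real.exp (-y) - 1 + y * (2 - Real.exp (-y))) / (2 - Real.exp (-y)) by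
          field_simp; ring]
      refine div_nonneg ?_ (by linarith)
      nlinarith [mul_nonneg hy0 (sub_nonneg.2 hp)]
  have h0 := hmono (Set.mem_Ici.2 le_rfl) (Set.mem_Ici.2 hx) hx
  norm_num at h0
  rw [← Real.le_log_iff_exp_le (by have := hpos x hx; linarith)]
  linarith

/-- Interleaving two tuples according to `τ`. -/
def interleave {Z ι : Type*} (τ : ι → Bool) (p : (ι → Z) × (ι → Z)) : (ι → Z) × (ι → Z) :=
  (fun i => if τ i then p.2 i else p.1 i, fun i => if τ i then p.1 i else p.2 i)

theorem measurePreserving_interleave {Z ι : Type*} [Fintype ι] [MeasurableSpace Z]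
    (Q : Measure Z) [IsProbabilityMeasure Q] (τ : ι → Bool) :
    MeasurePreserving (interleave τ)
      ((Measure.pi fun _ : ι => Q).prod (Measure.pi fun _ : ι => Q))
      ((Measure.pi fun _ : ι => Q).prod (Measure.pi fun _ : ι => Q)) := by
  have h1 := measurePreserving_arrowProdEquivProdArrow Z Z ι (fun _ => Q) (fun _ => Q)
  have h2 : MeasurePreserving
      (fun (a : ι → Z × Z) i => (if τ i then Prod.swap else id : Z × Z → Z × Z) (a i))
      (.pi fun _ : ι => Q.prod Q) (.pi fun _ : ι => Q.prod Q) := by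
    refine measurePreserving_pi _ _ fun i => ?_
    cases τ i
    · simpa using MeasurePreserving.id _
    · simpa using Measure.measurePreserving_swap
  have h3 := (h1.comp h2).comp (h1.symm _)
  convert h3 using 1
  ext p i
  · cases h : τ i <;> simp [interleave, h, MeasurableEquiv.arrowProdEquivProdArrow,
      Equiv.arrowProdEquivProdArrow]
  · cases h : τ i <;> simp [interleave, h, MeasurableEquiv.arrowProdEquivProdArrow,
      Equiv.arrowProdEquivProdArrow]

/-- Every swap preserves the law of the double sample, so the integral equals that of the average
over swaps. -/
theorem lintegral_le_of_sum_interleave_le {Z ι : Type*} [Fintype ι] [DecidableEq ι] [MeasurableSpace Z]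
    (Q : Measure Z) [IsProbabilityMeasure Q] {Φ : (ι → Z) × (ι → Z) → ℝ≥0∞} (hΦ : Measurable Φ)
    {c : ℝ≥0∞} (h : ∀ p, ∑ τ : ι → Bool, Φ (interleave τ p) ≤ 2 ^ Fintype.card ι * c) :
    ∫⁻ p, Φ p ∂((Measure.pi fun _ : ι => Q).prod (Measure.pi fun _ : ι => Q)) ≤ c := by
  set π := (Measure.pi fun _ : ι => Q).prod (Measure.pi fun _ : ι => Q)
  have h1 : ∀ τ : ι → Bool, ∫⁻ p, Φ (interleave τ p) ∂π = ∫⁻ p, Φ p ∂π := fun τ =>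
    (measurePreserving_interleave Q τ).lintegral_comp hΦ
  have h2 : 2 ^ Fintype.card ι * ∫⁻ p, Φ p ∂π ≤ 2 ^ Fintype.card ι * c := by
    calc 2 ^ Fintype.card ι * ∫⁻ p, Φ p ∂π
        = ∑ τ : ι → Bool, ∫⁻ p, Φ (interleave τ p) ∂π := by simp [h1]
      _ = ∫⁻ p, ∑ τ : ι → Bool, Φ (interleave τ p) ∂π :=
        (lintegral_finsetSum _ fun τ _ => hΦ.comp (measurePreserving_interleave Q τ).measurable).symm
      _ ≤ ∫⁻ _, 2 ^ Fintype.card ι * c ∂π := lintegral_mono h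
      _ = 2 ^ Fintype.card ι * c := by simp
  exact (ENNReal.mul_le_mul_iff_right (by simp) (by simp)).1 h2

/-- The integrand of the symmetrization argument. -/
def symmKernel {Z ι : Type*} [Fintype ι] (f : Z → ℝ) (p : (ι → Z) × (ι → Z)) : ℝ :=
  ∏ i, ((2 - Real.exp (-f (p.2 i))) * Real.exp (-f (p.1 i)))

/-- The parameter may depend on the swap. Summing over all patterns removes this dependence, and the
sum over swaps factorizes. With a, b ∈ [0, 1] the two exponentials, each factor is (2 - a)b + (2 -
b)a = 2 - 2(1 - a)(1 - b) ≤ 2. -/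
theorem sum_symmKernel_interleave_le {Z ι : Type*} [Fintype ι] [DecidableEq ι] (L : ℝ → Z → ℝ)
    (hL : ∀ θ z, 0 ≤ L θ z) (p : (ι → Z) × (ι → Z)) (V : Finset (ι × Bool → ℝ))
    (hV : ∀ θ, (fun q : ι × Bool => L θ (if q.2 then p.2 q.1 else p.1 q.1)) ∈ V)
    (θ : (ι → Bool) → ℝ) :
    ∑ τ : ι → Bool, symmKernel (L (θ τ)) (interleave τ p) ≤ 2 ^ Fintype.card ι * V.card := by
  let F : (ι × Bool → ℝ) → ι → Bool → ℝ := fun x i b =>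
    (2 - Real.exp (-x (i, !b))) * Real.exp (-x (i, b))
  -- Unrealized patterns in `V` may have negative entries and thus negative factors; they are
  -- discarded.
  let V' := V.filter fun x => ∀ q, 0 ≤ x q
  have hF0 : ∀ x ∈ V', ∀ i b, 0 ≤ F x i b := by
    intro x hx i b
    have : Real.exp (-x (i, !b)) ≤ 1 :=
      Real.exp_le_one_iff.2 (by linarith [(Finset.mem_filter.1 hx).2 (i, !b)])
    exact mul_nonneg (by linarith) (Real.exp_nonneg _)
  calc ∑ τ : ι → Bool, symmKernel (L (θ τ)) (interleave τ p)
      ≤ ∑ τ : ι → Bool, ∑ x ∈ V', ∏ i, F x i (τ i) := by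
        refine Finset.sum_le_sum fun τ _ => ?_
        have hmem : (fun q : ι × Bool => L (θ τ) (if q.2 then p.2 q.1 else p.1 q.1)) ∈ V' :=
          Finset.mem_filter.2 ⟨hV _, fun q => hL _ _⟩
        refine le_trans (le_of_eq ?_) (Finset.single_le_sum (f := fun x => ∏ i, F x i (τ i))
          (fun x hx => Finset.prod_nonneg fun i _ => hF0 x hx i _) hmem)
        refine Finset.prod_congr rfl fun i _ => ?_
        cases h : τ i <;> simp [F, interleave, h]
    _ = ∑ x ∈ V', ∏ i, ∑ b, F x i b := by
        rw [Finset.sum_comm]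
        refine Finset.sum_congr rfl fun x _ => ?_
        rw [Finset.prod_univ_sum, Fintype.piFinset_univ]
    _ ≤ ∑ x ∈ V', 2 ^ Fintype.card ι := by
        refine Finset.sum_le_sum fun x hx => ?_
        rw [← Finset.card_univ, ← Finset.prod_const]
        refine Finset.prod_le_prod (fun i _ => Finset.sum_nonneg fun b _ => hF0 x hx i b)
          fun i _ => ?_
        have h1 : Real.exp (-x (i, true)) ≤ 1 :=
          Real.exp_le_one_iff.2 (by linarith [(Finset.mem_filter.1 hx).2 (i, true)])
        have h2 : Real.exp (-x (i, false)) ≤ 1 :=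
          Real.exp_le_one_iff.2 (by linarith [(Finset.mem_filter.1 hx).2 (i, false)])
        simp only [F, Fintype.sum_bool, Bool.not_true, Bool.not_false]
        nlinarith [mul_nonneg (sub_nonneg.2 h1) (sub_nonneg.2 h2)]
    _ ≤ 2 ^ Fintype.card ι * V.card := by
        rw [Finset.sum_const, nsmul_eq_mul, mul_comm]
        gcongr
        exact Finset.filter_subset _ _

/-- Jensen's inequality for exp at the mean of f - f², in tangent-line form, followed by
`exp_sub_sq_le` pointwise. -/
theorem exp_le_integral_two_sub_exp_neg {Z : Type*} [MeasurableSpace Z] (Q : Measure Z)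
    [IsProbabilityMeasure Q] {f : Z → ℝ} (hf0 : ∀ z, 0 ≤ f z) (hf : Integrable f Q)
    (hf2 : Integrable (fun z => f z ^ 2) Q) :
    Real.exp (∫ z, f z ∂Q - ∫ z, f z ^ 2 ∂Q) ≤ ∫ z, (2 - Real.exp (-f z)) ∂Q := by
  set a := ∫ z, f z ∂Q - ∫ z, f z ^ 2 ∂Q
  have hi : Integrable (fun z => Real.exp (-f z)) Q := by
    refine Integrable.of_bound (C := 1) hf.aestronglyMeasurable.aemeasurable.neg.exp.aestronglyMeasurable
      (ae_of_all _ fun z => ?_)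
    rw [Real.norm_eq_abs, Real.abs_exp]
    exact Real.exp_le_one_iff.2 (by linarith [hf0 z])
  have hi2 : Integrable (fun z => Real.exp a * (f z - f z ^ 2)) Q := (hf.sub hf2).const_mul _
  have h1 : ∫ z, (Real.exp a * (1 - a) + Real.exp a * (f z - f z ^ 2)) ∂Q = Real.exp a := by
    rw [integral_add (integrable_const _) hi2, integral_const_mul (Real.exp a) (fun z => f z - f z ^ 2),
      integral_sub hf hf2]
    simp only [integral_const, probReal_univ, one_smul]
    change Real.exp a * (1 - a) + Real.exp a * a = _
    ring
  rw [← h1]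
  refine integral_mono ((integrable_const _).add hi2)
    ((integrable_const _).sub hi) fun z => ?_
  refine le_trans ?_ (exp_sub_sq_le (hf0 z))
  have h2 := Real.add_one_le_exp (f z - f z ^ 2 - a)
  have h3 : Real.exp (f z - f z ^ 2) = Real.exp a * Real.exp (f z - f z ^ 2 - a) := by
    rw [← Real.exp_add]; congr 1; ring
  rw [h3]
  nlinarith [Real.exp_pos a]

theorem exp_le_lintegral_symmKernel {Z ι : Type*} [Fintype ι] [MeasurableSpace Z] (Q : Measure Z)
    [IsProbabilityMeasure Q] {f : Z → ℝ} (hfm : Measurable f) (hf0 : ∀ z, 0 ≤ f z)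
    (hf : Integrable f Q) (hf2 : Integrable (fun z => f z ^ 2) Q) (s : ι → Z) :
    ENNReal.ofReal (Real.exp (Fintype.card ι * (∫ z, f z ∂Q - ∫ z, f z ^ 2 ∂Q) - ∑ i, f (s i)))
      ≤ ∫⁻ s', ENNReal.ofReal (symmKernel f (s, s')) ∂(Measure.pi fun _ : ι => Q) := by
  have hle : ∀ z, Real.exp (-f z) ≤ 1 := fun z => Real.exp_le_one_iff.2 (by linarith [hf0 z])
  have hk : (fun s' : ι → Z => symmKernel f (s, s')) = fun s' =>
      (∏ i, (2 - Real.exp (-f (s' i)))) * ∏ i, Real.exp (-f (s i)) := by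
    ext s'; simp [symmKernel, Finset.prod_mul_distrib]
  have hi : Integrable (fun z => 2 - Real.exp (-f z)) Q := by
    refine Integrable.of_bound (C := 2) (by fun_prop) (ae_of_all _ fun z => ?_)
    rw [Real.norm_eq_abs, abs_le]
    constructor <;> linarith [hle z, Real.exp_pos (-f z)]
  have hint : Integrable (fun s' : ι → Z => symmKernel f (s, s')) (Measure.pi fun _ : ι => Q) := by
    rw [hk]
    exact (Integrable.fintype_prod fun _ => hi).mul_const _
  rw [← ofReal_integral_eq_lintegral_ofReal hint]
  · apply ENNReal.ofReal_le_ofReal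
    rw [hk, integral_mul_const, integral_fintype_prod_eq_pow (ι := ι) (fun z => 2 - Real.exp (-f z)),
      sub_eq_add_neg, Real.exp_add, Real.exp_nat_mul, ← Finset.sum_neg_distrib, Real.exp_sum]
    gcongr
    exact exp_le_integral_two_sub_exp_neg Q hf0 hf hf2
  · refine ae_of_all _ fun s' => Finset.prod_nonneg fun i _ => mul_nonneg ?_ (Real.exp_nonneg _)
    linarith [hle (s' i)]

/-- One-sided uniform deviation bound for a measurable family of nonnegative functions with
bounded second moments that realizes at most `N` value patterns on each double sample. -/
theorem measure_exists_deviation_le {Z ι : Type*} [Fintype ι] [DecidableEq ι]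
    [MeasurableSpace Z] [StandardBorelSpace Z] (Q : Measure Z) [IsProbabilityMeasure Q] (L : ℝ → Z → ℝ)
    (hLm : Measurable (Function.uncurry L)) (hL0 : ∀ θ z, 0 ≤ L θ z)
    (hL1 : ∀ θ, Integrable (L θ) Q) (hL2 : ∀ θ, Integrable (fun z => L θ z ^ 2) Q)
    {v : ℝ} (hv : ∀ θ, ∫ z, L θ z ^ 2 ∂Q ≤ v) {N : ℕ}
    (hN : ∀ pt : ι × Bool → Z, ∃ V : Finset (ι × Bool → ℝ), V.card ≤ N ∧
      ∀ θ, (fun q => L θ (pt q)) ∈ V) (c : ℝ) :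
    (Measure.pi fun _ : ι => Q)
        {s | ∃ θ, c < Fintype.card ι * (∫ z, L θ z ∂Q - v) - ∑ i, L θ (s i)}
      ≤ ENNReal.ofReal (N * Real.exp (-c)) := by
  set π := Measure.pi fun _ : ι => Q
  have hLi : ∀ {α : Type _} [MeasurableSpace α] {a : α → ℝ} {b : α → Z}, Measurable a →
      Measurable b → Measurable fun x => L (a x) (b x) := fun ha hb =>
    hLm.comp (ha.prodMk hb)
  have hmean : Measurable fun θ => ∫ z, L θ z ∂Q :=
    (hLm.stronglyMeasurable.integral_prod_right (ν := Q)).measurable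
  let G : Set (ℝ × (ι → Z)) :=
    {x | c < Fintype.card ι * (∫ z, L x.1 z ∂Q - v) - ∑ i, L x.1 (x.2 i)}
  have hG : MeasurableSet G := by
    refine measurableSet_lt measurable_const ?_
    refine (((hmean.comp measurable_fst).sub_const _).const_mul _).sub ?_
    exact Finset.measurable_fun_sum _ fun i _ =>
      hLi measurable_fst ((measurable_pi_apply i).comp measurable_snd)
  have hproj : {s | ∃ θ, c < Fintype.card ι * (∫ z, L θ z ∂Q - v) - ∑ i, L θ (s i)}
      = Prod.snd '' G := by
    ext s
    constructor
    · rintro ⟨θ, h⟩; exact ⟨(θ, s), h, rfl⟩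
    · rintro ⟨⟨θ, s⟩, h, rfl⟩; exact ⟨θ, h⟩
  rw [hproj]
  -- The event is a projection and need not be measurable. If it were too large, a measurable choice
  -- `θ` of violating parameters on a set `A` would make the kernel integral exceed `N`.
  by_contra! hlt
  obtain ⟨c', hc1, hc2⟩ := exists_between hlt
  obtain ⟨A, hA, hcA, θ, hθ, hAG⟩ := exists_measurable_section π hG hc2
  refine absurd (hc1.trans_le hcA) (not_lt.2 ?_)
  have hΦ : Measurable fun p : (ι → Z) × (ι → Z) =>
      ENNReal.ofReal (symmKernel (L (θ p.1)) p) := by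
    refine ENNReal.measurable_ofReal.comp (Finset.measurable_fun_prod _ fun i _ => ?_)
    have h1 : Measurable fun p : (ι → Z) × (ι → Z) => L (θ p.1) (p.1 i) :=
      hLi (hθ.comp measurable_fst) ((measurable_pi_apply i).comp measurable_fst)
    have h2 : Measurable fun p : (ι → Z) × (ι → Z) => L (θ p.1) (p.2 i) :=
      hLi (hθ.comp measurable_fst) ((measurable_pi_apply i).comp measurable_snd)
    fun_prop
  have hupper : ∫⁻ p, ENNReal.ofReal (symmKernel (L (θ p.1)) p) ∂(π.prod π) ≤ N := by
    refine lintegral_le_of_sum_interleave_le Q hΦ fun p => ?_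
    obtain ⟨V, hVN, hV⟩ := hN fun q => if q.2 then p.2 q.1 else p.1 q.1
    rw [← ENNReal.ofReal_sum_of_nonneg]
    · have h1 := sum_symmKernel_interleave_le L hL0 p V hV fun τ => θ (interleave τ p).1
      refine (ENNReal.ofReal_le_ofReal (h1.trans
        (mul_le_mul_of_nonneg_left (Nat.cast_le.2 hVN) (by positivity)))).trans (le_of_eq ?_)
      rw [ENNReal.ofReal_mul (by positivity), ENNReal.ofReal_pow (by norm_num),
        ENNReal.ofReal_natCast]
      norm_num
    · intro τ _
      refine Finset.prod_nonneg fun i _ => mul_nonneg ?_ (Real.exp_nonneg _)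
      have : Real.exp (-L (θ (interleave τ p).1) ((interleave τ p).2 i)) ≤ 1 :=
        Real.exp_le_one_iff.2 (by linarith [hL0 (θ (interleave τ p).1) ((interleave τ p).2 i)])
      linarith
  have hlower : ENNReal.ofReal (Real.exp c) * π A
      ≤ ∫⁻ p, ENNReal.ofReal (symmKernel (L (θ p.1)) p) ∂(π.prod π) := by
    rw [lintegral_prod _ hΦ.aemeasurable, ← setLIntegral_const]
    refine (setLIntegral_mono' hA fun s hs => ?_).trans (setLIntegral_le_lintegral _ _)
    refine le_trans (ENNReal.ofReal_le_ofReal (Real.exp_le_exp.2 ?_))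
      (exp_le_lintegral_symmKernel Q (f := L (θ s)) (hLm.comp measurable_prodMk_left) (hL0 (θ s)) (hL1 _)
        (hL2 _) s)
    have h1 : c < Fintype.card ι * (∫ z, L (θ s) z ∂Q - v) - ∑ i, L (θ s) (s i) := hAG s hs
    have h2 : (Fintype.card ι : ℝ) * (∫ z, L (θ s) z ∂Q - v)
        ≤ Fintype.card ι * (∫ z, L (θ s) z ∂Q - ∫ z, L (θ s) z ^ 2 ∂Q) := by
      gcongr; exact hv _
    linarith
  have hfin := hlower.trans hupper
  rw [mul_comm, ← ENNReal.le_div_iff_mul_le (by simp [Real.exp_pos]) (by simp)] at hfin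
  refine hfin.trans (le_of_eq ?_)
  rw [Real.exp_neg, ← div_eq_mul_inv, ENNReal.ofReal_div_of_pos (Real.exp_pos c),
    ENNReal.ofReal_natCast]

/-! ### The explicit constant and the weighted deviation bound -/

theorem complexityTerm_pos {d m : ℕ} (hm : 0 < m) (hdm : d ≤ 2 * m) {δ : ℝ} (hδ0 : 0 < δ)
    (hδ1 : δ < 1) : 0 < complexityTerm d m δ ∧
      (d : ℝ) ≤ d * Real.log (Real.exp 1 * 2 * m / d) := by
  have hlog : 0 < Real.log (4 / δ) := Real.log_pos (by rw [lt_div_iff₀ hδ0]; linarith)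
  have hd : (d : ℝ) ≤ d * Real.log (Real.exp 1 * 2 * m / d) := by
    rcases Nat.eq_zero_or_pos d with rfl | hd
    · simp
    have hd' : (0 : ℝ) < d := by exact_mod_cast hd
    have hm' : (0 : ℝ) < m := by exact_mod_cast hm
    have hdm' : (d : ℝ) ≤ 2 * m := by exact_mod_cast hdm
    -- Since d ≤ 2m, the argument of the logarithm is at least e.
    refine le_mul_of_one_le_right hd'.le ?_
    rw [Real.le_log_iff_exp_le (by positivity), le_div_iff₀ hd']
    nlinarith [Real.exp_pos 1]
  refine ⟨?_, hd⟩
  have : (0 : ℝ) ≤ d := Nat.cast_nonneg d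
  exact mul_pos (by positivity) (Real.rpow_pos_of_pos (by linarith) _)

/-- If the deviation bound is nontrivial, rounding to about five times its inverse many levels
costs less than what the exponent leaves over. -/
theorem exists_levels {d m : ℕ} (hm : 0 < m) (hdm : d ≤ 2 * m) {δ : ℝ} (hδ0 : 0 < δ)
    (hδ1 : δ < 1) {t : ℝ} (ht : t = complexityTerm d m δ / (m : ℝ) ^ (3 / 8 : ℝ)) (ht1 : t < 1) :
    ∃ M : ℕ, 1 ≤ M ∧ 1 / ((M : ℝ) + 1) < t ∧
      d * Real.log (Real.exp 1 * (m * 2 * M : ℕ) / d) - m * (t - 1 / ((M : ℝ) + 1)) ^ 2 / 4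
        ≤ Real.log δ := by
  have hm' : (0 : ℝ) < m := by exact_mod_cast hm
  have hd0 : (0 : ℝ) ≤ d := Nat.cast_nonneg d
  obtain ⟨hpos, hdlog⟩ := complexityTerm_pos hm hdm hδ0 hδ1
  have ht0 : 0 < t := by rw [ht]; positivity
  have h4 : Real.log (4 / δ) = Real.log 4 - Real.log δ := Real.log_div (by norm_num) hδ0.ne'
  have hlδ : Real.log δ < 0 := Real.log_neg hδ0 hδ1
  have hl4 : 0 < Real.log 4 := Real.log_pos (by norm_num)
  set ℓd := Real.log (Real.exp 1 * 2 * m / d) with hℓd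
  set Λ := d * ℓd + Real.log (4 / δ) with hΛ
  have hΛ0 : 0 < Λ := by rw [hΛ, h4]; linarith
  -- The eighth root makes everything polynomial: Λ = m u⁸ and t = 2^(5/4) u³.
  set u := (Λ / m) ^ (1 / 8 : ℝ) with hu
  have hu0 : 0 < u := by positivity
  have hu8 : m * u ^ 8 = Λ := by
    rw [hu, ← Real.rpow_natCast, ← Real.rpow_mul (by positivity)]
    norm_num
    field_simp
  set c := (2 : ℝ) ^ (5 / 4 : ℝ) with hc
  have hc0 : 0 < c := by positivity
  have hc4 : c ^ 4 = 32 := by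
    rw [hc, ← Real.rpow_natCast, ← Real.rpow_mul (by positivity)]
    norm_num
  have hc2 : 5.65 ≤ c ^ 2 := by nlinarith [sq_nonneg c]
  have htu : t = c * u ^ 3 := by
    rw [ht, complexityTerm, ← hℓd, ← hΛ, ← hc, mul_div_assoc, ← Real.div_rpow hΛ0.le hm'.le,
      hu, ← Real.rpow_natCast ((Λ / m) ^ (1 / 8 : ℝ)), ← Real.rpow_mul (by positivity)]
    norm_num
  have ht2 : 5.65 * u ^ 6 ≤ t ^ 2 := by
    rw [htu, mul_pow, ← pow_mul]
    exact mul_le_mul_of_nonneg_right hc2 (by positivity)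
  have hu2 : u ^ 2 ≤ 0.6 := by
    by_contra! h
    have h6 : (0.6 : ℝ) ^ 3 ≤ (u ^ 2) ^ 3 := by gcongr
    have : t ^ 2 < 1 := by nlinarith
    rw [← pow_mul] at h6
    norm_num at h6
    linarith
  have hu6 : u ^ 8 ≤ 0.6 * u ^ 6 := by
    rw [show u ^ 8 = u ^ 2 * u ^ 6 by ring]
    gcongr
  -- With M + 1 = ⌈5/t⌉, rounding costs at most t/5 and leaves 0.8 t.
  set c5 := ⌈5 / t⌉₊ with hc5
  have h5t : 5 < 5 / t := by rw [lt_div_iff₀ ht0]; linarith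
  have h5c : 5 < c5 := Nat.lt_ceil.2 (by exact_mod_cast h5t)
  have hle : 5 / t ≤ c5 := Nat.le_ceil _
  have hlt : (c5 : ℝ) < 5 / t + 1 := Nat.ceil_lt_add_one (by positivity)
  have hM : ((c5 - 1 : ℕ) : ℝ) + 1 = c5 := by rw [Nat.cast_sub (by omega)]; simp
  have hM1 : (1 : ℝ) ≤ ((c5 - 1 : ℕ) : ℝ) := by
    have : (5 : ℝ) < c5 := by exact_mod_cast h5c
    linarith
  have h15 : 1 / (c5 : ℝ) ≤ t / 5 := by
    rw [div_le_iff₀ (by positivity)]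
    rw [div_le_iff₀ ht0] at hle
    linarith
  refine ⟨c5 - 1, by omega, ?_, ?_⟩
  · rw [hM]; linarith
  rw [hM]
  have hsq : (0.8 * t) ^ 2 ≤ (t - 1 / c5) ^ 2 := by
    have : 0.8 * t ≤ t - 1 / c5 := by linarith
    gcongr
  -- Numerically, 0.16 · 5.65 u⁶ ≥ 1.5 · 0.6 u⁶ ≥ 1.5 u⁸.
  have hexp : 1.5 * Λ ≤ m * (t - 1 / c5) ^ 2 / 4 := by
    rw [← hu8]
    have h1 : (0 : ℝ) < u ^ 6 := pow_pos hu0 6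
    have h2 : (0.8 * t) ^ 2 = 0.64 * t ^ 2 := by ring
    have h3 : 1.5 * u ^ 8 ≤ (t - 1 / c5) ^ 2 / 4 := by linarith
    have h4 := mul_le_mul_of_nonneg_left h3 hm'.le
    linarith
  have hlogM : d * Real.log (Real.exp 1 * (m * 2 * (c5 - 1) : ℕ) / d) ≤ 1.5 * (d * ℓd) := by
    rcases Nat.eq_zero_or_pos d with hd | hd
    · simp [hd]
    have hd' : (0 : ℝ) < d := by exact_mod_cast hd
    have hE : Real.exp 1 * ((m * 2 * (c5 - 1) : ℕ) : ℝ) / d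
        = (Real.exp 1 * 2 * m / d) * ((c5 - 1 : ℕ) : ℝ) := by
      push_cast; ring
    rw [hE, Real.log_mul (by positivity) (by linarith), ← hℓd]
    -- Thus log M is at most half of `ℓd`, and the entropy grows only by the factor 1.5 that `hexp`
    -- absorbs.
    have hM2 : (((c5 - 1 : ℕ) : ℝ)) ^ 2 ≤ Real.exp 1 * 2 * m / d := by
      have h1 : ((c5 - 1 : ℕ) : ℝ) ^ 2 ≤ (5 / t) ^ 2 := by
        have : ((c5 - 1 : ℕ) : ℝ) ≤ 5 / t := by linarith
        gcongr
      refine h1.trans ?_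
      rw [div_pow, div_le_div_iff₀ (by positivity) hd']
      have h2 : (d : ℝ) ≤ m * u ^ 8 := by rw [hu8, hΛ, h4]; linarith
      have h3 : m * (5.65 * u ^ 8) ≤ m * t ^ 2 := by
        have h61 : (0 : ℝ) < u ^ 6 := pow_pos hu0 6
        refine mul_le_mul_of_nonneg_left ?_ hm'.le
        linarith
      have he : 2.7 ≤ Real.exp 1 := by have := Real.exp_one_gt_d9; linarith
      have h6 : 5.4 * (m * t ^ 2) ≤ Real.exp 1 * 2 * m * t ^ 2 := by
        have := mul_le_mul_of_nonneg_right he (mul_pos hm' (pow_pos ht0 2)).le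
        linarith
      refine le_trans ?_ h6
      linarith
    have h7 := Real.log_le_log (by positivity) hM2
    rw [Real.log_pow, ← hℓd] at h7
    push_cast at h7
    have h8 : Real.log ((c5 - 1 : ℕ) : ℝ) ≤ 0.5 * ℓd := by linarith
    have h9 := mul_le_mul_of_nonneg_left h8 hd'.le
    linarith
  rw [hΛ, h4] at hexp
  linarith

/-- One-sided uniform deviation bound for weighted averages of a class of `[0, 1]`-valued functions
of finite pseudo-dimension. -/
theorem measure_exists_weighted_deviation_le {Z ι : Type*} [Fintype ι] [Nonempty ι]
    [MeasurableSpace Z] [StandardBorelSpace Z] (Q : Measure Z) [IsProbabilityMeasure Q]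
    (g : ℝ → Z → ℝ) (hgm : Measurable (Function.uncurry g)) (hg0 : ∀ θ z, 0 ≤ g θ z)
    (hg1 : ∀ θ z, g θ z ≤ 1) {d m : ℕ} (hm : Fintype.card ι = m)
    (hd : ∀ S : Finset Z, PseudoShatters (Set.range g) S → S.card ≤ d)
    (hdm : d ≤ 2 * m) {w : Z → ℝ} (hwm : Measurable w) (hw0 : ∀ z, 0 ≤ w z)
    (hw : Integrable w Q) (hw1 : ∫ z, w z ∂Q ≤ 1) (hw2 : Integrable (fun z => w z ^ 2) Q)
    {σ : ℝ} (hσ1 : 1 ≤ σ) (hσ : ∫ z, w z ^ 2 ∂Q ≤ σ ^ 2) {δ : ℝ} (hδ0 : 0 < δ) (hδ1 : δ < 1)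
    {t : ℝ} (ht : t = complexityTerm d m δ / (m : ℝ) ^ (3 / 8 : ℝ)) :
    (Measure.pi fun _ : ι => Q)
        {s | ∃ θ, t * σ < ∫ z, w z * g θ z ∂Q - (∑ i, w (s i) * g θ (s i)) / m}
      ≤ ENNReal.ofReal δ := by
  classical
  have hm0 : 0 < m := hm ▸ Fintype.card_pos
  have hm' : (0 : ℝ) < m := by exact_mod_cast hm0
  have hσ0 : 0 < σ := by linarith
  have hgθ : ∀ θ, Measurable (g θ) := fun θ => hgm.comp measurable_prodMk_left
  have hwb : ∀ b : Z → ℝ, Measurable b → (∀ z, 0 ≤ b z) → (∀ z, b z ≤ 1) →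
      Integrable (fun z => w z * b z) Q := by
    intro b hb hb0 hb1
    have hmeas : Measurable fun z => w z * b z := hwm.mul hb
    refine hw.mono hmeas.aestronglyMeasurable (ae_of_all _ fun z => ?_)
    rw [Real.norm_of_nonneg (mul_nonneg (hw0 z) (hb0 z)), Real.norm_of_nonneg (hw0 z)]
    exact mul_le_of_le_one_right (hw0 z) (hb1 z)
  by_cases ht1 : t < 1
  swap
  -- For t ≥ 1 the bound is trivial: the deviation is at most ∫ w ≤ 1 ≤ tσ.
  · have hempty : {s : ι → Z | ∃ θ, t * σ <
        ∫ z, w z * g θ z ∂Q - (∑ i, w (s i) * g θ (s i)) / m} = ∅ := by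
      refine Set.eq_empty_iff_forall_notMem.2 fun s hs => ?_
      obtain ⟨θ, h⟩ := hs
      have h1 : ∫ z, w z * g θ z ∂Q ≤ ∫ z, w z ∂Q :=
        integral_mono (hwb _ (hgθ θ) (hg0 θ) (hg1 θ)) hw fun z =>
          mul_le_of_le_one_right (hw0 z) (hg1 θ z)
      have h2 : 0 ≤ (∑ i, w (s i) * g θ (s i)) / m :=
        div_nonneg (Finset.sum_nonneg fun i _ => mul_nonneg (hw0 _) (hg0 _ _)) hm'.le
      nlinarith
    rw [hempty]
    simp
  obtain ⟨M, hM1, hMt, hexp⟩ := exists_levels hm0 hdm hδ0 hδ1 ht ht1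
  set t0 := t - 1 / ((M : ℝ) + 1) with ht0
  have ht0pos : 0 < t0 := by linarith
  obtain ⟨r, hr⟩ : ∃ r : ℝ → Z → ℝ, ∀ θ z, r θ z = roundDown M (g θ z) := ⟨_, fun _ _ => rfl⟩
  have hrm : Measurable (Function.uncurry r) := by
    have h : Function.uncurry r = roundDown M ∘ Function.uncurry g := by
      ext p; exact hr p.1 p.2
    rw [h]
    exact (measurable_roundDown M).comp hgm
  have hrθ : ∀ θ, Measurable (r θ) := fun θ => hrm.comp measurable_prodMk_left
  have hr0 : ∀ θ z, 0 ≤ r θ z := fun θ z => by rw [hr]; exact roundDown_nonneg _ _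
  have hrg : ∀ θ z, r θ z ≤ g θ z := fun θ z => by rw [hr]; exact roundDown_le _ (hg0 _ _)
  have hr1 : ∀ θ z, r θ z ≤ 1 := fun θ z => (hrg θ z).trans (hg1 θ z)
  -- This maximizes λ t₀ σ - λ² σ², with value t₀²/4.
  set lam := t0 / (2 * σ) with hlam
  have hlam0 : 0 < lam := by positivity
  have hsq : ∀ θ z, (w z * r θ z) ^ 2 ≤ w z ^ 2 := fun θ z => by
    have := mul_le_of_le_one_right (hw0 z) (hr1 θ z)
    have := mul_nonneg (hw0 z) (hr0 θ z)
    gcongr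
  have hwr2 : ∀ θ, Integrable (fun z => (w z * r θ z) ^ 2) Q := fun θ => by
    have hmeas : Measurable fun z => (w z * r θ z) ^ 2 := (hwm.mul (hrθ θ)).pow_const 2
    refine hw2.mono hmeas.aestronglyMeasurable (ae_of_all _ fun z => ?_)
    rw [Real.norm_of_nonneg (sq_nonneg _), Real.norm_of_nonneg (sq_nonneg _)]
    exact hsq θ z
  obtain ⟨N, hN⟩ : ∃ N, N = ∑ i ∈ Finset.range (d + 1), (m * 2 * M).choose i := ⟨_, rfl⟩
  have hpat : ∀ pt : ι × Bool → Z, ∃ V : Finset (ι × Bool → ℝ), V.card ≤ N ∧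
      ∀ θ, (fun q => lam * (w (pt q) * r θ (pt q))) ∈ V := by
    intro pt
    simp only [hr]
    obtain ⟨V, hV, hmem⟩ := exists_finset_roundDown g hg1 hd pt M
    rw [Fintype.card_prod, Fintype.card_bool, hm, ← hN] at hV
    refine ⟨V.image fun x q => lam * (w (pt q) * x q), Finset.card_image_le.trans hV, fun θ => ?_⟩
    exact Finset.mem_image_of_mem (fun x q => lam * (w (pt q) * x q)) (hmem θ)
  have hdev := measure_exists_deviation_le (ι := ι) Q (fun θ z => lam * (w z * r θ z))
    (((hwm.comp measurable_snd).mul hrm).const_mul lam)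
    (fun θ z => mul_nonneg hlam0.le (mul_nonneg (hw0 z) (hr0 θ z)))
    (fun θ => (hwb _ (hrθ θ) (hr0 θ) (hr1 θ)).const_mul lam)
    (fun θ => by simp_rw [mul_pow lam]; exact (hwr2 θ).const_mul _)
    (v := lam ^ 2 * σ ^ 2)
    (fun θ => by
      simp_rw [mul_pow lam]
      rw [integral_const_mul]
      gcongr
      exact (integral_mono (hwr2 θ) hw2 (hsq θ)).trans hσ)
    hpat (m * t0 ^ 2 / 4)
  rw [hm] at hdev
  refine (measure_mono ?_).trans (hdev.trans (ENNReal.ofReal_le_ofReal ?_))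
  · rintro s ⟨θ, h⟩
    refine ⟨θ, ?_⟩
    have hi1 := hwb _ (hgθ θ) (hg0 θ) (hg1 θ)
    have hi2 := hwb _ (hrθ θ) (hr0 θ) (hr1 θ)
    have h1 : ∫ z, w z * g θ z ∂Q - 1 / ((M : ℝ) + 1) ≤ ∫ z, w z * r θ z ∂Q := by
      have h2 : ∫ z, w z * g θ z ∂Q ≤ ∫ z, (w z * r θ z + w z * (1 / ((M : ℝ) + 1))) ∂Q := by
        refine integral_mono hi1 (hi2.add (hw.mul_const _)) fun z => ?_
        rw [← mul_add, hr]
        exact mul_le_mul_of_nonneg_left (le_roundDown_add M _) (hw0 z)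
      rw [integral_add hi2 (hw.mul_const _), integral_mul_const] at h2
      have h3 : (∫ z, w z ∂Q) * (1 / ((M : ℝ) + 1)) ≤ 1 * (1 / ((M : ℝ) + 1)) := by gcongr
      linarith
    have h4 : ∑ i, w (s i) * r θ (s i) ≤ ∑ i, w (s i) * g θ (s i) :=
      Finset.sum_le_sum fun i _ => mul_le_mul_of_nonneg_left (hrg θ _) (hw0 _)
    -- The rounding error enters only through the mean, where ∫ w ≤ 1 bounds it by 1/(M+1); σ ≥ 1
    -- then absorbs it.
    have h5 : t0 * σ ≤ t * σ - 1 / ((M : ℝ) + 1) := by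
      have : 0 < 1 / ((M : ℝ) + 1) := by positivity
      rw [ht0]; nlinarith
    have h6 : m * (t0 * σ) < m * ∫ z, w z * r θ z ∂Q - ∑ i, w (s i) * r θ (s i) := by
      have h7 : t0 * σ < ∫ z, w z * r θ z ∂Q - (∑ i, w (s i) * g θ (s i)) / m := by linarith
      have h8 := mul_lt_mul_of_pos_left h7 hm'
      rw [mul_sub, mul_div_cancel₀ _ hm'.ne'] at h8
      linarith
    have h9 := mul_lt_mul_of_pos_left h6 hlam0
    simp only [integral_const_mul]
    rw [← Finset.mul_sum]
    have h10 : lam * σ = t0 / 2 := by rw [hlam]; field_simp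
    have h11 : lam ^ 2 * σ ^ 2 = t0 ^ 2 / 4 := by rw [← mul_pow, h10]; ring
    have h12 : lam * (m * (t0 * σ)) = m * t0 ^ 2 / 2 := by
      rw [show lam * (m * (t0 * σ)) = m * t0 * (lam * σ) by ring, h10]; ring
    rw [h11]
    rw [h12] at h9
    linarith
  · have hNle := sum_choose_le_exp (n := m * 2 * M) (d := d) (by nlinarith)
    rw [← hN] at hNle
    calc _ ≤ Real.exp (d * Real.log (Real.exp 1 * (m * 2 * M : ℕ) / d))
          * Real.exp (-(m * t0 ^ 2 / 4)) := mul_le_mul_of_nonneg_right hNle (Real.exp_nonneg _)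
      _ ≤ δ := by
        rw [← Real.exp_add, ← Real.le_log_iff_exp_le hδ0]
        linarith

/-! ### Measurability and the law of the at-risk subsample -/

namespace Population

variable {Ω 𝒳 : Type*} [MeasurableSpace Ω] [MeasurableSpace 𝒳]

theorem measurable_events (P : Population Ω 𝒳) (aY aD elim : Bool) (k : ℕ) :
    Measurable fun ω => P.events aY aD elim ω k := by
  induction k with
  | zero => exact measurable_const
  | succ k ih =>
    have h : Measurable fun x : (Bool × Bool) × (Bool × Bool) =>
        ((x.1.1 || (!(!elim && (x.1.2 || (!x.1.1 && x.2.1))) && x.2.2),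
          !elim && (x.1.2 || (!x.1.1 && x.2.1))) : Bool × Bool) := Measurable.of_discrete
    exact h.comp (ih.prodMk ((P.measurable_mechD (k + 1) aD).prodMk
      (P.measurable_mechY (k + 1) aY)))

theorem measurable_observedEvents (P : Population Ω 𝒳) (k : ℕ) :
    Measurable fun ω => P.events (P.A ω) (P.A ω) false ω k := by
  have h : (fun ω => P.events (P.A ω) (P.A ω) false ω k) = fun ω =>
      if P.A ω = true then P.events true true false ω k else P.events false false false ω k := by
    ext1 ω
    cases hA : P.A ω <;> simp
  rw [h]
  exact Measurable.ite (P.measurable_A (measurableSet_singleton true))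
    (P.measurable_events _ _ _ k) (P.measurable_events _ _ _ k)

theorem measurable_Y (P : Population Ω 𝒳) (k : ℕ) : Measurable (P.Y k) :=
  measurable_fst.comp (P.measurable_observedEvents k)

theorem measurable_D (P : Population Ω 𝒳) (k : ℕ) : Measurable (P.D k) :=
  measurable_snd.comp (P.measurable_observedEvents k)

theorem measurableSet_atRisk (P : Population Ω 𝒳) (a : Bool) (k : ℕ) :
    MeasurableSet (P.atRisk a k) := by
  have h : P.atRisk a k = P.A ⁻¹' {a} ∩
      ((⋂ l : ℕ, ⋂ _ : l < k, P.Y l ⁻¹' {false}) ∩ ⋂ l : ℕ, ⋂ _ : l ≤ k, P.D l ⁻¹' {false}) := by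
    ext ω
    simp [atRisk]
  rw [h]
  exact (P.measurable_A (measurableSet_singleton a)).inter
    ((MeasurableSet.iInter fun l => MeasurableSet.iInter fun _ =>
      P.measurable_Y l (measurableSet_singleton false)).inter
    (MeasurableSet.iInter fun l => MeasurableSet.iInter fun _ =>
      P.measurable_D l (measurableSet_singleton false)))

end Population

/-- Conditionally on the set of indices at which an i.i.d. sample hits `E`, the subsample at those
indices is i.i.d. from the conditional law given `E`. -/
theorem cond_pi_map_subsample {Ω Z : Type*} [MeasurableSpace Ω] [MeasurableSpace Z]
    (μ : Measure Ω) [IsProbabilityMeasure μ] {E : Set Ω} (hE : MeasurableSet E) {T : Ω → Z}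
    (hT : Measurable T) {n : ℕ} (I : Finset (Fin n))
    (h0 : (Measure.pi fun _ : Fin n => μ) {s | ∀ i, s i ∈ E ↔ i ∈ I} ≠ 0) :
    (ProbabilityTheory.cond (Measure.pi fun _ : Fin n => μ) {s | ∀ i, s i ∈ E ↔ i ∈ I}).map
        (fun s (i : I) => T (s i))
      = Measure.pi fun _ : I => (ProbabilityTheory.cond μ E).map T := by
  classical
  set S : Fin n → Set Ω := fun i => if i ∈ I then E else Eᶜ with hS
  have hSm : ∀ i, MeasurableSet (S i) := fun i => by
    simp only [hS]; split_ifs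
    exacts [hE, hE.compl]
  -- The conditioning event is a product set, so conditioning acts coordinatewise; coordinates
  -- outside `I` contribute the factor 1.
  have hev : {s : Fin n → Ω | ∀ i, s i ∈ E ↔ i ∈ I} = Set.univ.pi S := by
    ext s
    simp only [Set.mem_ofPred_eq, Set.mem_univ_pi, hS]
    refine forall_congr' fun i => ?_
    by_cases hi : i ∈ I <;> simp [hi]
  rw [hev] at h0 ⊢
  have hS0 : ∀ i, μ (S i) ≠ 0 := by
    rw [Measure.pi_pi] at h0
    exact fun i => Finset.prod_ne_zero_iff.1 h0 i (Finset.mem_univ i)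
  have hρ : Measurable fun (s : Fin n → Ω) (i : I) => T (s i) :=
    measurable_pi_iff.2 fun i => hT.comp (measurable_pi_apply _)
  symm
  refine Measure.pi_eq fun t ht => ?_
  set t' : Fin n → Set Z := fun i => if h : i ∈ I then t ⟨i, h⟩ else Set.univ with ht'
  have htt' : ∀ i : I, t i = t' i := fun i => by simp [ht']
  rw [Measure.map_apply hρ (MeasurableSet.univ_pi ht), cond_apply (MeasurableSet.univ_pi hSm)]
  have hinter : Set.univ.pi S ∩ (fun (s : Fin n → Ω) (i : I) => T (s i)) ⁻¹' Set.univ.pi t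
      = Set.univ.pi fun i => S i ∩ T ⁻¹' t' i := by
    ext s
    simp only [Set.mem_inter_iff, Set.mem_preimage, Set.mem_univ_pi, forall_and]
    refine and_congr_right fun _ => ⟨fun h i => ?_, fun h i => ?_⟩
    · by_cases hi : i ∈ I
      · rw [← htt' ⟨i, hi⟩]; exact h ⟨i, hi⟩
      · simp [ht', hi]
    · rw [htt' i]; exact h i
  have hinv : (∏ i, μ (S i))⁻¹ = ∏ i, (μ (S i))⁻¹ :=
    ENNReal.prod_inv_distrib fun _ _ _ _ _ => Or.inr (measure_ne_top _ _)
  rw [hinter, Measure.pi_pi, Measure.pi_pi, hinv, ← Finset.prod_mul_distrib]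
  have hfac : ∀ i, (μ (S i))⁻¹ * μ (S i ∩ T ⁻¹' t' i)
      = if i ∈ I then (ProbabilityTheory.cond μ E).map T (t' i) else 1 := by
    intro i
    by_cases hi : i ∈ I
    · have hti : MeasurableSet (t' i) := by rw [← htt' ⟨i, hi⟩]; exact ht _
      rw [if_pos hi, Measure.map_apply hT hti, cond_apply hE]
      simp [hS, hi]
    · rw [if_neg hi]
      have : t' i = Set.univ := by simp [ht', hi]
      rw [this, Set.preimage_univ, Set.inter_univ]
      exact ENNReal.inv_mul_cancel (hS0 i) (measure_ne_top _ _)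
  rw [Finset.prod_congr rfl fun i _ => hfac i, Finset.prod_ite_mem, Finset.univ_inter,
    ← Finset.prod_coe_sort]
  exact Finset.prod_congr rfl fun i _ => by rw [htt' i]

/-- An integral against a joint law with a binary second coordinate. -/
theorem integral_map_prod_bool {Ω 𝒳 : Type*} [MeasurableSpace Ω] [MeasurableSpace 𝒳]
    (ν : Measure Ω) [IsProbabilityMeasure ν] {X : Ω → 𝒳} {Y : Ω → Bool}
    (hY : Measurable Y) {F : 𝒳 × Bool → ℝ}
    (hF : Integrable F (ν.map fun ω => (X ω, Y ω))) :
    ∫ z, F z ∂(ν.map fun ω => (X ω, Y ω))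
      = ∫ x, ((condDistrib Y X ν x).real {true} * F (x, true)
        + (1 - (condDistrib Y X ν x).real {true}) * F (x, false)) ∂(ν.map X) := by
  have h : (ν.map X) ⊗ₘ condDistrib Y X ν = ν.map fun ω => (X ω, Y ω) :=
    compProd_map_condDistrib hY.aemeasurable
  rw [← h] at hF ⊢
  rw [Measure.integral_compProd hF]
  refine integral_congr_ae (ae_of_all _ fun x => ?_)
  have hfalse : (condDistrib Y X ν x).real {false} = 1 - (condDistrib Y X ν x).real {true} := by
    rw [← probReal_compl_eq_one_sub (measurableSet_singleton true)]
    congr 1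
    ext b; cases b <;> simp
  simp only [integral_fintype Integrable.of_finite, Fintype.sum_bool, smul_eq_mul, hfalse]

/-! ### Rényi divergence and moments of the weight -/

section Renyi

variable {𝒳 : Type*} [MeasurableSpace 𝒳] (p q : Measure 𝒳)

theorem essRel_eq_zero (h : ¬ (p ≪ q ∧ ∫⁻ x, p.rnDeriv q x ∂p ≠ ⊤)) : essRel p q = 0 := by
  have hlog : (0 : ℝ) < Real.log 2 := Real.log_pos (by norm_num)
  have hR : renyiTwo p q = ⊤ := by
    unfold renyiTwo
    split_ifs with hpq
    · have : ∫⁻ x, p.rnDeriv q x ∂p = ⊤ := by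
        by_contra hne
        exact h ⟨hpq, hne⟩
      rw [this, ENNReal.log_top, EReal.top_div_of_pos_ne_top (by exact_mod_cast hlog) (by simp)]
    · rfl
  rw [essRel, hR, exp2, EReal.neg_top, EReal.bot_mul_coe_of_pos hlog, EReal.exp_bot]

theorem essRel_eq {σ : ℝ} (hσ : 0 < σ) (hpq : p ≪ q)
    (h : ∫⁻ x, p.rnDeriv q x ∂p = ENNReal.ofReal (σ ^ 2)) :
    essRel p q = ENNReal.ofReal ((σ ^ 2)⁻¹) := by
  have hlog : Real.log 2 ≠ 0 := (Real.log_pos (by norm_num)).ne'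
  rw [essRel, exp2, renyiTwo, if_pos hpq, h, ENNReal.log_ofReal_of_pos (by positivity),
    ← EReal.coe_div, ← EReal.coe_neg, ← EReal.coe_mul, EReal.exp_coe]
  congr 1
  rw [neg_mul, div_mul_cancel₀ _ hlog, Real.exp_neg, Real.exp_log (by positivity)]

theorem bound_eq {C σ : ℝ} {m : ℕ} (hm : 0 < m) (hσ : 0 < σ) (hC : 0 < C) :
    ENNReal.ofReal C / (ENNReal.ofReal ((σ ^ 2)⁻¹) ^ (1 / 2 : ℝ) * (m : ℝ≥0∞) ^ (3 / 8 : ℝ))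
      = ENNReal.ofReal (C / (m : ℝ) ^ (3 / 8 : ℝ) * σ) := by
  have hm' : (0 : ℝ) < m := by exact_mod_cast hm
  rw [ENNReal.ofReal_rpow_of_pos (by positivity), ← ENNReal.ofReal_natCast,
    ENNReal.ofReal_rpow_of_pos hm', ← ENNReal.ofReal_mul (by positivity),
    ← ENNReal.ofReal_div_of_pos (by positivity)]
  congr 1
  have : ((σ ^ 2)⁻¹ : ℝ) ^ (1 / 2 : ℝ) = σ⁻¹ := by
    rw [← Real.sqrt_eq_rpow, ← inv_pow, Real.sqrt_sq (by positivity)]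
  rw [this]
  field_simp

end Renyi

theorem card_le_of_pseudoDim_eq {Z : Type*} {G : Set (Z → ℝ)} {d : ℕ} (h : pseudoDim G = (d : ℕ∞))
    (S : Finset Z) (hS : PseudoShatters G S) : S.card ≤ d := by
  have h1 : (S.card : ℕ∞) ≤ pseudoDim G := le_iSup₂ (f := fun (S : Finset Z)
    (_ : PseudoShatters G S) => (S.card : ℕ∞)) S hS
  rw [h] at h1
  exact_mod_cast h1

/-- First and second moments of a square integrable density. -/
theorem moments_toReal_rnDeriv {𝒳 : Type*} [MeasurableSpace 𝒳] (p q : Measure 𝒳)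
    [IsProbabilityMeasure p] [IsProbabilityMeasure q] (hpq : p ≪ q)
    (h : ∫⁻ x, p.rnDeriv q x ∂p ≠ ⊤) :
    ∫ x, (p.rnDeriv q x).toReal ∂q = 1 ∧ Integrable (fun x => (p.rnDeriv q x).toReal ^ 2) q ∧
      ∃ σ : ℝ, 1 ≤ σ ∧ ∫ x, (p.rnDeriv q x).toReal ^ 2 ∂q = σ ^ 2 ∧
        ∫⁻ x, p.rnDeriv q x ∂p = ENNReal.ofReal (σ ^ 2) := by
  have hone : ∫ x, (p.rnDeriv q x).toReal ∂q = 1 := by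
    rw [Measure.integral_toReal_rnDeriv hpq, probReal_univ]
  have hint : Integrable (fun x => (p.rnDeriv q x).toReal) q := Measure.integrable_toReal_rnDeriv
  have hmeas : Measurable fun x => (p.rnDeriv q x).toReal :=
    (Measure.measurable_rnDeriv p q).ennreal_toReal
  have hsq : ∫⁻ x, ENNReal.ofReal ((p.rnDeriv q x).toReal ^ 2) ∂q = ∫⁻ x, p.rnDeriv q x ∂p := by
    rw [← lintegral_rnDeriv_mul hpq (Measure.measurable_rnDeriv p q).aemeasurable]
    refine lintegral_congr_ae ?_
    filter_upwards [Measure.rnDeriv_lt_top p q] with x hx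
    rw [ENNReal.ofReal_pow ENNReal.toReal_nonneg, ENNReal.ofReal_toReal hx.ne, sq]
  have hint2 : Integrable (fun x => (p.rnDeriv q x).toReal ^ 2) q := by
    refine ⟨(hmeas.pow_const 2).aestronglyMeasurable, ?_⟩
    rw [hasFiniteIntegral_iff_ofReal (ae_of_all _ fun x => sq_nonneg _), hsq]
    exact lt_top_iff_ne_top.2 h
  -- Integrate 2w - 1 ≤ w², using that w has mean 1.
  have hge : 1 ≤ ∫ x, (p.rnDeriv q x).toReal ^ 2 ∂q := by
    have h1 : ∫ x, (2 * (p.rnDeriv q x).toReal - 1) ∂q ≤ ∫ x, (p.rnDeriv q x).toReal ^ 2 ∂q :=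
      integral_mono ((hint.const_mul 2).sub (integrable_const 1)) hint2 fun x => by
        change 2 * (p.rnDeriv q x).toReal - 1 ≤ (p.rnDeriv q x).toReal ^ 2
        nlinarith [sq_nonneg ((p.rnDeriv q x).toReal - 1)]
    rw [integral_sub (hint.const_mul 2) (integrable_const 1), integral_const_mul, hone] at h1
    simp only [integral_const, probReal_univ, one_smul] at h1
    linarith
  refine ⟨hone, hint2, √(∫ x, (p.rnDeriv q x).toReal ^ 2 ∂q), Real.one_le_sqrt.2 hge, ?_, ?_⟩
  · rw [Real.sq_sqrt (by linarith)]
  · rw [Real.sq_sqrt (by linarith), ← hsq, ofReal_integral_eq_lintegral_ofReal hint2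
      (ae_of_all _ fun x => sq_nonneg _)]

/-! ### The two risks in terms of the at-risk law -/

namespace Population

variable {Ω 𝒳 : Type*} [MeasurableSpace Ω] [MeasurableSpace 𝒳]

/-- The interventional risk as a weighted observational expectation. -/
theorem riskInt_eq_integral (P : Population Ω 𝒳) (μ : Measure Ω) [IsProbabilityMeasure μ]
    (v : Intervention) (k : ℕ) (hE : μ (P.atRisk v.armY k) ≠ 0)
    (hpq : P.pInt μ v k ≪ P.pObs μ v.armY k) {ℓ : Bool → ℝ → ℝ} {h : 𝒳 → ℝ}
    (hℓ : ∀ y, Measurable fun x => ℓ y (h x)) (hℓ01 : ∀ y x, ℓ y (h x) ∈ Set.Icc (0 : ℝ) 1) :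
    P.riskInt μ v k ℓ h = ∫ z, P.weightStar μ v k z.1 * ℓ z.2 (h z.1)
      ∂((ProbabilityTheory.cond μ (P.atRisk v.armY k)).map fun ω => (P.X ω, P.Y k ω)) := by
  have := cond_isProbabilityMeasure hE
  set ν := ProbabilityTheory.cond μ (P.atRisk v.armY k) with hν
  have hT : Measurable fun ω => (P.X ω, P.Y k ω) := P.measurable_X.prodMk (P.measurable_Y k)
  have : IsFiniteMeasure (P.pInt μ v k) := by unfold pInt; infer_instance
  have : IsFiniteMeasure (P.pObs μ v.armY k) := by unfold pObs; infer_instance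
  have hwm : Measurable (P.weightStar μ v k) :=
    (Measure.measurable_rnDeriv _ _).ennreal_toReal
  have hwi : Integrable (P.weightStar μ v k) (P.pObs μ v.armY k) :=
    Measure.integrable_toReal_rnDeriv
  have hgm : Measurable fun z : 𝒳 × Bool => ℓ z.2 (h z.1) :=
    measurable_from_prod_countable_left fun y => hℓ y
  have hfst : (ν.map fun ω => (P.X ω, P.Y k ω)).map Prod.fst = P.pObs μ v.armY k := by
    rw [Measure.map_map measurable_fst hT]; rfl
  have hwz : Integrable (fun z : 𝒳 × Bool => P.weightStar μ v k z.1)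
      (ν.map fun ω => (P.X ω, P.Y k ω)) := by
    rw [← hfst] at hwi
    exact hwi.comp_measurable measurable_fst
  have hF : Integrable (fun z : 𝒳 × Bool => P.weightStar μ v k z.1 * ℓ z.2 (h z.1))
      (ν.map fun ω => (P.X ω, P.Y k ω)) := by
    have hm : Measurable fun z : 𝒳 × Bool => P.weightStar μ v k z.1 * ℓ z.2 (h z.1) :=
      (hwm.comp measurable_fst).mul hgm
    refine hwz.mono hm.aestronglyMeasurable (ae_of_all _ fun z => ?_)
    rw [norm_mul]
    refine mul_le_of_le_one_right (norm_nonneg _) ?_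
    rw [Real.norm_of_nonneg (hℓ01 _ _).1]
    exact (hℓ01 _ _).2
  rw [integral_map_prod_bool ν (P.measurable_Y k) hF, riskInt, ← integral_rnDeriv_smul hpq]
  refine integral_congr_ae (ae_of_all _ fun x => ?_)
  simp only [hazardY, weightStar, smul_eq_mul, ← hν]
  ring

theorem riskEmp_eq (P : Population Ω 𝒳) (w : 𝒳 → ℝ) (a : Bool) (k : ℕ) (ℓ : Bool → ℝ → ℝ) {n : ℕ}
    {s : Fin n → Ω} {I : Finset (Fin n)} (hs : P.atRiskIndices a k s = I) (h : 𝒳 → ℝ) :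
    P.riskEmp w a k ℓ s h
      = (∑ i : I, w (P.X (s i)) * ℓ (P.Y k (s i)) (h (P.X (s i)))) / (I.card : ℝ) := by
  rw [riskEmp, hs, Finset.sum_coe_sort I
    fun i => w (P.X (s i)) * ℓ (P.Y k (s i)) (h (P.X (s i)))]

end Population

end CompetingEvents

end

/-! ### The bound conditional on the at-risk set -/

theorem corollary1 {Ω 𝒳 : Type*} [MeasurableSpace Ω] [MeasurableSpace 𝒳] [StandardBorelSpace 𝒳]
    (μ : Measure Ω) [IsProbabilityMeasure μ] (P : CompetingEvents.Population Ω 𝒳)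
    (v : CompetingEvents.Intervention) (k : ℕ) (hk : 1 ≤ k)
    (H : Set (𝒳 → ℝ)) (hH : CompetingEvents.JointlyMeasurableClass H)
    (ℓ : Bool → ℝ → ℝ) (hℓ : ∀ y, Measurable (ℓ y))
    (hℓ01 : ∀ h ∈ H, ∀ y x, ℓ y (h x) ∈ Set.Icc (0 : ℝ) 1)
    (d : ℕ) (hd : CompetingEvents.pseudoDim (CompetingEvents.lossClass ℓ H) = (d : ℕ∞))
    (δ : ℝ) (hδ0 : 0 < δ) (hδ1 : δ < 1)
    (n : ℕ) (I : Finset (Fin n)) (hI : I.Nonempty) (hdI : d ≤ 2 * I.card) :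
    ProbabilityTheory.cond (Measure.pi fun _ : Fin n => μ)
        {s | P.atRiskIndices v.armY k s = I}
        {s | ¬ ∀ h ∈ H,
          ((P.riskInt μ v k ℓ h
              - P.riskEmp (P.weightStar μ v k) v.armY k ℓ s h : ℝ) : EReal)
            ≤ ((ENNReal.ofReal (CompetingEvents.complexityTerm d I.card δ)
                / (CompetingEvents.essRel (P.pInt μ v k) (P.pObs μ v.armY k) ^ (1 / 2 : ℝ)
                  * (I.card : ℝ≥0∞) ^ (3 / 8 : ℝ)) : ℝ≥0∞) : EReal)}
      ≤ ENNReal.ofReal δ := by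
  classical
  have hcard : 0 < I.card := hI.card_pos
  have hIne : Nonempty I := hI.to_subtype
  obtain ⟨hC, -⟩ := CompetingEvents.complexityTerm_pos hcard hdI hδ0 hδ1
  set p := P.pInt μ v k with hp
  set q := P.pObs μ v.armY k with hq
  have hempty : (∀ s : Fin n → Ω, ∀ h ∈ H,
      ((P.riskInt μ v k ℓ h - P.riskEmp (P.weightStar μ v k) v.armY k ℓ s h : ℝ) : EReal)
        ≤ ((ENNReal.ofReal (CompetingEvents.complexityTerm d I.card δ)
          / (CompetingEvents.essRel p q ^ (1 / 2 : ℝ)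
            * (I.card : ℝ≥0∞) ^ (3 / 8 : ℝ)) : ℝ≥0∞) : EReal)) →
      ProbabilityTheory.cond (Measure.pi fun _ : Fin n => μ)
        {s | P.atRiskIndices v.armY k s = I}
        {s | ¬ ∀ h ∈ H,
          ((P.riskInt μ v k ℓ h
              - P.riskEmp (P.weightStar μ v k) v.armY k ℓ s h : ℝ) : EReal)
            ≤ ((ENNReal.ofReal (CompetingEvents.complexityTerm d I.card δ)
                / (CompetingEvents.essRel p q ^ (1 / 2 : ℝ)
                  * (I.card : ℝ≥0∞) ^ (3 / 8 : ℝ)) : ℝ≥0∞) : EReal)}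
      ≤ ENNReal.ofReal δ := by
    intro h
    refine (measure_mono (t := ∅) fun s hs => ?_).trans (by simp)
    rw [Set.mem_ofPred_eq] at hs
    exact hs (h s)
  by_cases hess : p ≪ q ∧ ∫⁻ x, p.rnDeriv q x ∂p ≠ ⊤
  swap
  · refine hempty fun s h _ => ?_
    rw [CompetingEvents.essRel_eq_zero p q hess, ENNReal.zero_rpow_of_pos (by norm_num), zero_mul,
      ENNReal.div_zero (by simpa using hC)]
    exact le_top
  -- Conditioning on a null event gives the zero measure, so the interventional risk is 0 and the
  -- claim is trivial.
  by_cases hint : μ (P.atRiskInt v k) = 0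
  · refine hempty fun s h hh => ?_
    have hp0 : P.pInt μ v k = 0 := by
      rw [CompetingEvents.Population.pInt, ProbabilityTheory.cond_eq_zero.2 (Or.inr hint),
        Measure.map_zero]
    have h1 : P.riskInt μ v k ℓ h = 0 := by
      rw [CompetingEvents.Population.riskInt, hp0, integral_zero_measure]
    have h2 : 0 ≤ P.riskEmp (P.weightStar μ v k) v.armY k ℓ s h :=
      div_nonneg (Finset.sum_nonneg fun i _ =>
        mul_nonneg ENNReal.toReal_nonneg (hℓ01 h hh _ _).1) (Nat.cast_nonneg _)
    refine le_trans (EReal.coe_le_coe_iff.2 (show _ ≤ (0 : ℝ) by rw [h1]; linarith)) ?_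
    exact EReal.coe_ennreal_nonneg _
  have hset : {s : Fin n → Ω | P.atRiskIndices v.armY k s = I}
      = {s | ∀ i, s i ∈ P.atRisk v.armY k ↔ i ∈ I} := by
    ext s
    simp [CompetingEvents.Population.atRiskIndices, Finset.ext_iff]
  have hEm := P.measurableSet_atRisk v.armY k
  by_cases hev : (Measure.pi fun _ : Fin n => μ) {s | P.atRiskIndices v.armY k s = I} = 0
  · rw [ProbabilityTheory.cond_eq_zero.2 (Or.inr hev)]
    simp
  have hE0 : μ (P.atRisk v.armY k) ≠ 0 := by
    obtain ⟨i, hi⟩ := hI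
    intro h0
    refine hev (measure_mono_null (fun s hs => ?_)
      ((measurePreserving_eval (fun _ : Fin n => μ) i).quasiMeasurePreserving.preimage_null h0))
    rw [hset] at hs
    exact (hs i).2 hi
  set ν := ProbabilityTheory.cond μ (P.atRisk v.armY k) with hν
  have : IsProbabilityMeasure ν := ProbabilityTheory.cond_isProbabilityMeasure hE0
  have : IsProbabilityMeasure (ProbabilityTheory.cond μ (P.atRiskInt v k)) :=
    ProbabilityTheory.cond_isProbabilityMeasure hint
  have hpprob : IsProbabilityMeasure p :=
    Measure.isProbabilityMeasure_map P.measurable_X.aemeasurable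
  have hqprob : IsProbabilityMeasure q :=
    Measure.isProbabilityMeasure_map P.measurable_X.aemeasurable
  have hT : Measurable fun ω => (P.X ω, P.Y k ω) := P.measurable_X.prodMk (P.measurable_Y k)
  have hQprob : IsProbabilityMeasure (ν.map fun ω => (P.X ω, P.Y k ω)) :=
    Measure.isProbabilityMeasure_map hT.aemeasurable
  have hfst : MeasurePreserving Prod.fst (ν.map fun ω => (P.X ω, P.Y k ω)) q :=
    ⟨measurable_fst, by rw [Measure.map_map measurable_fst hT]; rfl⟩
  have hcomp : ∀ F : 𝒳 → ℝ, Measurable F →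
      ∫ z, F z.1 ∂(ν.map fun ω => (P.X ω, P.Y k ω)) = ∫ x, F x ∂q := fun F hF => by
    rw [← hfst.map_eq, integral_map measurable_fst.aemeasurable hF.aestronglyMeasurable]
  obtain ⟨hone, hint2, σ, hσ1, hσ, hσ'⟩ :=
    CompetingEvents.moments_toReal_rnDeriv p q hess.1 hess.2
  have hσ0 : 0 < σ := by linarith
  have hwm : Measurable (P.weightStar μ v k) := (Measure.measurable_rnDeriv _ _).ennreal_toReal
  obtain ⟨f, hf, rfl⟩ := hH
  have hfθ : ∀ θ, Measurable (f θ) := fun θ => hf.comp measurable_prodMk_left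
  have hgm : Measurable
      (Function.uncurry fun (θ : ℝ) (z : 𝒳 × Bool) => ℓ z.2 (f θ z.1)) := by
    have h1 : Measurable fun x : (ℝ × 𝒳) × Bool => ℓ x.2 (f x.1.1 x.1.2) :=
      measurable_from_prod_countable_left fun y => (hℓ y).comp hf
    exact h1.comp ((measurable_fst.prodMk (measurable_fst.comp measurable_snd)).prodMk
      (measurable_snd.comp measurable_snd))
  have hcore := CompetingEvents.measure_exists_weighted_deviation_le (ι := I)
    (ν.map fun ω => (P.X ω, P.Y k ω)) (fun θ z => ℓ z.2 (f θ z.1)) hgm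
    (fun θ z => (hℓ01 _ ⟨θ, rfl⟩ _ _).1) (fun θ z => (hℓ01 _ ⟨θ, rfl⟩ _ _).2)
    (Fintype.card_coe I)
    (fun S hS => CompetingEvents.card_le_of_pseudoDim_eq hd S (by
      rw [CompetingEvents.lossClass, ← Set.range_comp]; exact hS))
    hdI (w := fun z => P.weightStar μ v k z.1) (hwm.comp measurable_fst)
    (fun z => ENNReal.toReal_nonneg)
    (hfst.integrable_comp_of_integrable Measure.integrable_toReal_rnDeriv)
    (le_of_eq ((hcomp _ hwm).trans hone))
    (hfst.integrable_comp_of_integrable hint2) hσ1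
    (le_of_eq ((hcomp _ (hwm.pow_const 2)).trans hσ)) hδ0 hδ1 rfl
  rw [hset] at hev ⊢
  rw [← CompetingEvents.cond_pi_map_subsample μ hEm hT I hev] at hcore
  have hρ : Measurable fun (s : Fin n → Ω) (i : I) => (P.X (s i), P.Y k (s i)) :=
    measurable_pi_iff.2 fun i => hT.comp (measurable_pi_apply _)
  -- The deviation set is not known to be measurable; for outer measures only this inequality is
  -- available, and it goes the right way.
  refine le_trans ?_ ((Measure.le_map_apply hρ.aemeasurable _).trans hcore)
  have hevm : MeasurableSet {s : Fin n → Ω | ∀ i, s i ∈ P.atRisk v.armY k ↔ i ∈ I} := by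
    have h : {s : Fin n → Ω | ∀ i, s i ∈ P.atRisk v.armY k ↔ i ∈ I}
        = ⋂ i, {s : Fin n → Ω | s i ∈ P.atRisk v.armY k ↔ i ∈ I} := by
      ext s; simp
    rw [h]
    refine MeasurableSet.iInter fun i => ?_
    have hm : Measurable fun s : Fin n → Ω => s i := measurable_pi_apply i
    by_cases hi : i ∈ I
    · convert hEm.preimage hm using 1
      ext s; simp [hi]
    · convert hEm.compl.preimage hm using 1
      ext s; simp [hi]
  refine measure_mono_ae ?_
  filter_upwards [ProbabilityTheory.ae_cond_mem hevm] with s hsI hs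
  change s ∈ {s : Fin n → Ω | ∀ i, s i ∈ P.atRisk v.armY k ↔ i ∈ I} at hsI
  rw [← hset, Set.mem_ofPred_eq] at hsI
  by_contra hgood
  refine hs ?_
  rintro _ ⟨θ, rfl⟩
  rw [CompetingEvents.essRel_eq p q hσ0 hess.1 hσ', CompetingEvents.bound_eq hcard hσ0 hC,
    EReal.coe_ennreal_ofReal, EReal.coe_le_coe_iff,
    P.riskInt_eq_integral μ v k hE0 hess.1 (fun y => (hℓ y).comp (hfθ θ))
      (hℓ01 _ ⟨θ, rfl⟩), P.riskEmp_eq _ _ _ _ hsI]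
  refine le_trans (not_lt.1 fun hlt => hgood ⟨θ, hlt⟩) (le_max_left _ _)
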